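/- All spaces below are topological spaces. A subset $U$ of a space $X$ is *numerically open* if $P^{-1}(U)$ is open for every continuous map $P\colon V\to X$ from an open subset $V$ of a Euclidean space; $X$ is *numerically generated* if each of its numerically open subsets is open. Let $\mathbf{NG}$ be the full subcategory of $\mathbf{Top}$ of numerically generated spaces, and let $\mathbf{NG}_*$ and $\mathbf{Top}_*$ be the categories of pointed objects (spaces under the one-point space) of $\mathbf{NG}$ and $\mathbf{Top}$. Write $X_+=X\sqcup\{*\}$ for the space $X$ with a disjoint base point added. Let $$I_+=\{(S^{n-1})_+\to (D^n)_+ : n\ge 0\},\qquad J_+=\{(D^n\times\{0\})_+\to (D^n\times[0,1])_+ : n\ge 0\}$$ be the sets of pointed maps induced by the inclusions (with $S^{-1}=\emptyset$); all these spaces are numerically generated, so $I_+$ and $J_+$ are sets of maps in $\mathbf{NG}_*$ as well as in $\mathbf{Top}_*$. A map is a weak homotopy equivalence if it induces a bijection on path components and isomorphisms on all homotopy groups $\pi_n$, $n>0$, at all base points. Model categories are understood in the sense of Hovey: they have all small limits and colimits, and functorial factorizations. A model structure is *cofibrantly generated* by sets of maps $I$ (generating cofibrations) and $J$ (generating trivial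 cofibrations) if the domains of $I$, respectively $J$, are small relative to the relative $I$-cell, respectively $J$-cell, complexes, the fibrations are the maps with the right lifting property with respect to $J$, and the trivial fibrations are the maps with the right lifting property with respect to $I$. It is *finitely generated* if moreover the domains and codomains of the maps in $I$ and $J$ are finite relative to the relative $I$-cell complexes (that is, $\operatorname{Hom}(A,-)$ commutes with colimits of $\lambda$-sequences of relative $I$-cell complexes for all limit ordinals $\lambda$). **Corollary 3.4.** There is a finitely generated model structure on $\mathbf{NG}_*$ with generating cofibrations $I_+$ and generating trivial cofibrations $J_+$; its weak equivalences are the pointed maps whose underlying maps are weak homotopy equivalences. Moreover, the inclusion functor $i_*\colon\mathbf{NG}_*\to\mathbf{Top}_*$ is a (left) Quillen equivalence, where $\mathbf{Top}_*$ carries its standard model structure, i.e. the finitely generated one with generating cofibrations $I_+$, generating trivial cofibrations $J_+$ and weak equivalences the pointed maps whose underlying maps are weak homotopy equivalences: $i_*$ has a right adjoint $\nu_*$, it preserves cofibrations and trivial cofibrations, and for $X$ cofibrant in $\mathbf{NG}_*$ and $Y$ fibrant in $\mathbf{Top}_*$ a map $i_*X\to Y$ is a weak equivalence if and only if its adjoint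 $X\to\nu_*Y$ is. -/

import Mathlib

open CategoryTheory Limits HomotopicalAlgebra

universe w v v' u u'

/-! ### Numerically generated spaces -/

namespace NumericallyGenerated

/-- A subset `U` of a space `X` is numerically open if `P ⁻¹' U` is open for every continuous map
`P : V → X` defined on an open subset `V` of a Euclidean space. -/
def IsNumericallyOpen {X : Type u} [TopologicalSpace X] (U : Set X) : Prop :=
  ∀ (n : ℕ) (V : Set (EuclideanSpace ℝ (Fin n))), IsOpen V →
    ∀ P : C(V, X), IsOpen (P ⁻¹' U)

/-- A space is numerically generated if all its numerically open subsets are open. -/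
def IsNumericallyGenerated (X : Type u) [TopologicalSpace X] : Prop :=
  ∀ U : Set X, IsNumericallyOpen U → IsOpen U

lemma IsNumericallyOpen.preimage {X Y : Type u} [TopologicalSpace X] [TopologicalSpace Y]
    {U : Set Y} (hU : IsNumericallyOpen U) (f : C(X, Y)) : IsNumericallyOpen (f ⁻¹' U) :=
  fun n V hV P => hU n V hV (f.comp P)

/-- A retract of an open subset of a finite-dimensional normed space is numerically generated. -/
lemma isNumericallyGenerated_of_retract {E : Type} [NormedAddCommGroup E] [NormedSpace ℝ E]
    [FiniteDimensional ℝ E] {X : Type u} [TopologicalSpace X] (V : Set E) (hV : IsOpen V)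
    (r : C(V, X)) (s : C(X, V)) (h : ∀ x, r (s x) = x) : IsNumericallyGenerated X := by
  intro U hU
  let e : E ≃L[ℝ] EuclideanSpace ℝ (Fin (Module.finrank ℝ E)) := toEuclidean
  let W : Set (EuclideanSpace ℝ (Fin (Module.finrank ℝ E))) := e.symm ⁻¹' V
  have hW : IsOpen W := hV.preimage e.symm.continuous
  let a : C(W, V) := ⟨fun x => ⟨e.symm x.1, x.2⟩, by fun_prop⟩
  let b : C(V, W) := ⟨fun x => ⟨e x.1, by simp [W]⟩, by fun_prop⟩
  have h1 := (hU _ W hW (r.comp a)).preimage (b.comp s).continuous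
  convert h1 using 1
  ext x
  have : a (b (s x)) = s x := by
    apply Subtype.ext
    simp [a, b]
  simp [this, h]

lemma isNumericallyGenerated_sum {X Y : Type u} [TopologicalSpace X] [TopologicalSpace Y]
    (hX : IsNumericallyGenerated X) (hY : IsNumericallyGenerated Y) :
    IsNumericallyGenerated (X ⊕ Y) := by
  intro U hU
  rw [isOpen_sum_iff]
  exact ⟨hX _ (hU.preimage ⟨Sum.inl, continuous_inl⟩),
    hY _ (hU.preimage ⟨Sum.inr, continuous_inr⟩)⟩

lemma isNumericallyGenerated_punit : IsNumericallyGenerated PUnit.{u + 1} :=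
  fun _ _ => isOpen_discrete _

/-- The radial retraction of a Euclidean space onto its closed unit ball. -/
noncomputable def ballRetraction (n : ℕ) :
    C(EuclideanSpace ℝ (Fin n), Metric.closedBall (0 : EuclideanSpace ℝ (Fin n)) 1) where
  toFun x := ⟨(max 1 ‖x‖)⁻¹ • x, by
    have h1 : (0 : ℝ) < max 1 ‖x‖ := lt_of_lt_of_le one_pos (le_max_left _ _)
    rw [mem_closedBall_zero_iff, norm_smul, norm_inv, Real.norm_of_nonneg h1.le,
      inv_mul_le_iff₀ h1, mul_one]
    exact le_max_right _ _⟩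
  continuous_toFun := by
    have h : Continuous fun x : EuclideanSpace ℝ (Fin n) => (max 1 ‖x‖)⁻¹ • x :=
      Continuous.smul (Continuous.inv₀ (continuous_const.max continuous_norm) fun x =>
        (lt_of_lt_of_le one_pos (le_max_left _ _)).ne') continuous_id
    exact h.subtype_mk _

lemma ballRetraction_coe (n : ℕ) (x : Metric.closedBall (0 : EuclideanSpace ℝ (Fin n)) 1) :
    ballRetraction n x = x := by
  apply Subtype.ext
  have : ‖(x : EuclideanSpace ℝ (Fin n))‖ ≤ 1 := mem_closedBall_zero_iff.1 x.2
  simp [ballRetraction, max_eq_left this]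

lemma isNumericallyGenerated_disk (n : ℕ) : IsNumericallyGenerated (TopCat.disk.{u} n) :=
  isNumericallyGenerated_of_retract (E := EuclideanSpace ℝ (Fin n)) Set.univ isOpen_univ
    ⟨fun x => ULift.up (ballRetraction n x.1),
      continuous_uliftUp.comp ((ballRetraction n).continuous.comp continuous_subtype_val)⟩
    ⟨fun x => ⟨(ULift.down x).1, trivial⟩,
      Continuous.subtype_mk (continuous_subtype_val.comp continuous_uliftDown) _⟩
    (fun x => congrArg ULift.up (ballRetraction_coe n (ULift.down x)))

/-- The radial retraction of a punctured Euclidean space onto its unit sphere. -/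
noncomputable def sphereRetraction (n : ℕ) :
    C(({0}ᶜ : Set (EuclideanSpace ℝ (Fin n))),
      Metric.sphere (0 : EuclideanSpace ℝ (Fin n)) 1) where
  toFun x := ⟨‖x.1‖⁻¹ • x.1, by
    rw [mem_sphere_zero_iff_norm, norm_smul, norm_inv, norm_norm]
    exact inv_mul_cancel₀ (norm_ne_zero_iff.2 x.2)⟩
  continuous_toFun := by
    have h : Continuous fun x : ({0}ᶜ : Set (EuclideanSpace ℝ (Fin n))) => ‖x.1‖⁻¹ • x.1 :=
      Continuous.smul (Continuous.inv₀ continuous_subtype_val.norm fun x =>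
        norm_ne_zero_iff.2 x.2) continuous_subtype_val
    exact h.subtype_mk _

lemma isNumericallyGenerated_diskBoundary (n : ℕ) :
    IsNumericallyGenerated (TopCat.diskBoundary.{u} n) :=
  isNumericallyGenerated_of_retract (E := EuclideanSpace ℝ (Fin n)) {0}ᶜ
    isOpen_compl_singleton
    ⟨fun x => ULift.up (sphereRetraction n x),
      continuous_uliftUp.comp (sphereRetraction n).continuous⟩
    ⟨fun x => ⟨(ULift.down x).1, ne_zero_of_mem_unit_sphere _⟩,
      Continuous.subtype_mk (continuous_subtype_val.comp continuous_uliftDown) _⟩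
    (fun x => by
      obtain ⟨⟨x, hx⟩⟩ := x
      have h : ‖x‖ = 1 := mem_sphere_zero_iff_norm.1 hx
      apply congrArg ULift.up
      apply Subtype.ext
      change ‖x‖⁻¹ • x = x
      simp [h])

/-- The cylinder `Dⁿ × [0, 1]`. -/
noncomputable def diskCylinder (n : ℕ) : TopCat.{u} :=
  TopCat.of (TopCat.disk.{u} n × TopCat.I.{u})

lemma isNumericallyGenerated_diskCylinder (n : ℕ) :
    IsNumericallyGenerated (diskCylinder.{u} n) :=
  isNumericallyGenerated_of_retract (E := EuclideanSpace ℝ (Fin n) × ℝ) Set.univ isOpen_univ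
    ⟨fun x => (ULift.up (ballRetraction n x.1.1),
        ULift.up (Set.projIcc (0 : ℝ) 1 zero_le_one x.1.2)),
      (continuous_uliftUp.comp (by fun_prop)).prodMk
        (continuous_uliftUp.comp (continuous_projIcc.comp (by fun_prop)))⟩
    ⟨fun x => ⟨((ULift.down x.1).1, (ULift.down x.2).1), trivial⟩,
      Continuous.subtype_mk
        ((continuous_subtype_val.comp (continuous_uliftDown.comp continuous_fst)).prodMk
          (continuous_subtype_val.comp (continuous_uliftDown.comp continuous_snd))) _⟩
    (fun x => Prod.ext
      (congrArg ULift.up (ballRetraction_coe n (ULift.down x.1)))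
      (congrArg ULift.up (Set.projIcc_val zero_le_one (ULift.down x.2))))

/-- The category `NG`: the full subcategory of `Top` of numerically generated spaces. -/
abbrev NG : Type (u + 1) :=
  ObjectProperty.FullSubcategory (fun X : TopCat.{u} => IsNumericallyGenerated X)

/-- The inclusion functor `NG ⥤ Top`. -/
abbrev inclusion : NG.{u} ⥤ TopCat.{u} := ObjectProperty.ι _

/-! ### Pointed spaces -/

/-- The one-point space. -/
abbrev pt : TopCat.{u} := TopCat.of PUnit.{u + 1}

/-- The one-point space, as an object of `NG`. -/
abbrev ptNG : NG.{u} := ⟨pt, isNumericallyGenerated_punit⟩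

/-- The category of pointed spaces: spaces `X` with a map from the one-point space to `X`. -/
abbrev PointedTop : Type (u + 1) := Under pt.{u}

/-- The category `NG_*` of pointed numerically generated spaces. -/
abbrev PointedNG : Type (u + 1) := Under ptNG.{u}

/-- The inclusion functor `i_* : NG_* ⥤ Top_*`. -/
def pointedInclusion : PointedNG.{u} ⥤ PointedTop.{u} := Under.post (X := ptNG.{u}) inclusion.{u}

/-- The functor `X ↦ X₊ = X ⊔ {*}` which adds a disjoint base point to a space. -/
def addPoint : TopCat.{u} ⥤ PointedTop.{u} where
  obj X := Under.mk (Y := TopCat.of (X ⊕ PUnit.{u + 1}))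
    (TopCat.ofHom ⟨Sum.inr, continuous_inr⟩)
  map f := Under.homMk
    (TopCat.ofHom ⟨Sum.map f id, f.hom.continuous.sumMap continuous_id⟩)
  map_id X := by
    ext x
    rcases x with x | x <;> rfl
  map_comp f g := by
    ext x
    rcases x with x | x <;> rfl

/-- The functor `X ↦ X₊ = X ⊔ {*}` from `NG` to `NG_*`. -/
def addPointNG : NG.{u} ⥤ PointedNG.{u} where
  obj X := Under.mk
    (Y := (⟨TopCat.of (X.obj ⊕ PUnit.{u + 1}),
      isNumericallyGenerated_sum X.property isNumericallyGenerated_punit⟩ : NG.{u}))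
    (ObjectProperty.homMk (TopCat.ofHom ⟨Sum.inr, continuous_inr⟩))
  map f := Under.homMk (ObjectProperty.homMk
    (TopCat.ofHom ⟨Sum.map f.hom id, f.hom.hom.continuous.sumMap continuous_id⟩))
  map_id X := by
    ext x
    rcases x with x | x <;> rfl
  map_comp f g := by
    ext x
    rcases x with x | x <;> rfl

/-! ### The generating (trivial) cofibrations -/

/-- The inclusion `Dⁿ = Dⁿ × {0} → Dⁿ × [0, 1]`. -/
noncomputable def diskCylinderInclusion (n : ℕ) : TopCat.disk.{u} n ⟶ diskCylinder.{u} n :=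
  TopCat.ofHom ⟨fun x => (x, ULift.up 0), by fun_prop⟩

/-- The boundary inclusion `Sⁿ⁻¹ → Dⁿ`, as a morphism of `NG`. -/
noncomputable def boundaryInclusionNG (n : ℕ) :
    (⟨TopCat.diskBoundary.{u} n, isNumericallyGenerated_diskBoundary n⟩ : NG.{u}) ⟶
      ⟨TopCat.disk.{u} n, isNumericallyGenerated_disk n⟩ :=
  ObjectProperty.homMk (TopCat.diskBoundaryInclusion n)

/-- The inclusion `Dⁿ → Dⁿ × [0, 1]`, as a morphism of `NG`. -/
noncomputable def diskCylinderInclusionNG (n : ℕ) :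
    (⟨TopCat.disk.{u} n, isNumericallyGenerated_disk n⟩ : NG.{u}) ⟶
      ⟨diskCylinder.{u} n, isNumericallyGenerated_diskCylinder n⟩ :=
  ObjectProperty.homMk (diskCylinderInclusion n)

/-- The set `I₊` of maps `(Sⁿ⁻¹)₊ → (Dⁿ)₊`, `n ≥ 0`, in `Top_*`. -/
noncomputable def genCofTop : MorphismProperty PointedTop.{u} :=
  MorphismProperty.ofHoms fun n : ℕ => addPoint.map (TopCat.diskBoundaryInclusion.{u} n)

/-- The set `J₊` of maps `(Dⁿ)₊ → (Dⁿ × [0, 1])₊`, `n ≥ 0`, in `Top_*`. -/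
noncomputable def genTrivCofTop : MorphismProperty PointedTop.{u} :=
  MorphismProperty.ofHoms fun n : ℕ => addPoint.map (diskCylinderInclusion.{u} n)

/-- The set `I₊` of maps `(Sⁿ⁻¹)₊ → (Dⁿ)₊`, `n ≥ 0`, in `NG_*`. -/
noncomputable def genCofNG : MorphismProperty PointedNG.{u} :=
  MorphismProperty.ofHoms fun n : ℕ => addPointNG.map (boundaryInclusionNG.{u} n)

/-- The set `J₊` of maps `(Dⁿ)₊ → (Dⁿ × [0, 1])₊`, `n ≥ 0`, in `NG_*`. -/
noncomputable def genTrivCofNG : MorphismProperty PointedNG.{u} :=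
  MorphismProperty.ofHoms fun n : ℕ => addPointNG.map (diskCylinderInclusionNG.{u} n)

/-! ### Weak homotopy equivalences -/

/-- The map induced by a continuous map on path components. -/
def mapZerothHomotopy {X Y : Type u} [TopologicalSpace X] [TopologicalSpace Y] (f : C(X, Y)) :
    ZerothHomotopy X → ZerothHomotopy Y :=
  Quotient.map f fun _ _ h => h.map f.continuous

/-- The map `π_n (X, x) → π_n (Y, f x)` induced by a continuous map `f`. -/
def mapHomotopyGroup {X Y : Type u} [TopologicalSpace X] [TopologicalSpace Y] (f : C(X, Y))
    (n : ℕ) (x : X) : HomotopyGroup.Pi n X x → HomotopyGroup.Pi n Y (f x) :=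
  Quotient.map (fun p : GenLoop (Fin n) X x =>
      (⟨f.comp p.1, fun y hy => congrArg f (p.2 y hy)⟩ : GenLoop (Fin n) Y (f x)))
    fun _ _ h => ContinuousMap.HomotopicRel.comp_continuousMap h f

/-- A continuous map is a weak homotopy equivalence if it induces a bijection on path components
and isomorphisms on all the homotopy groups `π_n`, `n > 0`, at all base points. -/
def IsWeakHomotopyEquivalence {X Y : Type u} [TopologicalSpace X] [TopologicalSpace Y]
    (f : C(X, Y)) : Prop :=
  Function.Bijective (mapZerothHomotopy f) ∧
    ∀ (n : ℕ), 0 < n → ∀ x : X, Function.Bijective (mapHomotopyGroup f n x)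

/-- The pointed maps whose underlying map is a weak homotopy equivalence, in `Top_*`. -/
def weakEqTop : MorphismProperty PointedTop.{u} :=
  fun _ _ f => IsWeakHomotopyEquivalence f.right.hom

/-- The pointed maps whose underlying map is a weak homotopy equivalence, in `NG_*`. -/
def weakEqNG : MorphismProperty PointedNG.{u} :=
  fun _ _ f => IsWeakHomotopyEquivalence f.right.hom.hom

end NumericallyGenerated

/-! ### Finitely generated model structures -/

namespace ModelStructure

section Small

variable {C : Type u} [Category.{v} C]

/-- The class of relative `I`-cell complexes: transfinite compositions of pushouts of elements
of `I`. -/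
def cell (I : MorphismProperty C) : MorphismProperty C :=
  MorphismProperty.transfiniteCompositions.{v} I.pushouts

/-- An object `A` is `κ`-small relative to a class of morphisms `W` if `Hom(A, -)` commutes with
the colimits of all `λ`-sequences of morphisms in `W`, for every `κ`-filtered ordinal `λ`, i.e.
every limit ordinal all of whose subsets of cardinality at most `κ` are bounded.
A `λ`-sequence is a functor `F` on `λ` which preserves colimits at limit ordinals `< λ`, and it
consists of morphisms in `W` if `F j ⟶ F (j + 1)` is in `W` for all `j`. -/
def IsCardinalSmallRel (κ : Cardinal.{v}) (W : MorphismProperty C) (A : C) : Prop :=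
  ∀ (J : Type v) [LinearOrder J] [SuccOrder J] [OrderBot J] [WellFoundedLT J] [NoMaxOrder J],
    (∀ S : Set J, Cardinal.mk S ≤ κ → BddAbove S) →
    ∀ (F : J ⥤ C), F.IsWellOrderContinuous → (∀ j : J, W (F.map (homOfLE (Order.le_succ j)))) →
      PreservesColimit F (coyoneda.obj (Opposite.op A))

/-- An object is small relative to `W` if it is `κ`-small relative to `W` for some `κ`. -/
def IsSmallRel (W : MorphismProperty C) (A : C) : Prop :=
  ∃ κ : Cardinal.{v}, IsCardinalSmallRel κ W A

/-- An object is finite relative to `W` if it is `κ`-small relative to `W` for some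
finite `κ`. -/
def IsFiniteRel (W : MorphismProperty C) (A : C) : Prop :=
  ∃ κ : Cardinal.{v}, κ < Cardinal.aleph0 ∧ IsCardinalSmallRel κ W A

end Small

/-- The given classes of cofibrations, fibrations and weak equivalences are a cofibrantly generated
model structure (on a category with all small limits and colimits, and with functorial
factorizations), with `I` as the set of generating cofibrations and `J` as the set of generating
trivial cofibrations. -/
structure IsCofibrantlyGenerated (C : Type u) [Category.{v} C] [ModelCategory C]
    (I J : MorphismProperty C) : Prop where
  hasLimits : HasLimits C
  hasColimits : HasColimits C
  functorial_left :
    (trivialCofibrations C).HasFunctorialFactorization (fibrations C)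
  functorial_right :
    (cofibrations C).HasFunctorialFactorization (trivialFibrations C)
  isSmall_left : MorphismProperty.IsSmall.{v} I
  isSmall_right : MorphismProperty.IsSmall.{v} J
  small_dom_left : ∀ ⦃A B : C⦄ (f : A ⟶ B), I f → IsSmallRel (cell I) A
  small_dom_right : ∀ ⦃A B : C⦄ (f : A ⟶ B), J f → IsSmallRel (cell J) A
  fibrations_eq : fibrations C = J.rlp
  trivialFibrations_eq : trivialFibrations C = I.rlp

/-- A cofibrantly generated model structure is finitely generated if the domains and codomains of
the elements of `I` and `J` are finite relative to the relative `I`-cell complexes. -/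
structure IsFinitelyGenerated (C : Type u) [Category.{v} C] [ModelCategory C]
    (I J : MorphismProperty C) : Prop extends IsCofibrantlyGenerated C I J where
  finite_left : ∀ ⦃A B : C⦄ (f : A ⟶ B), I f →
    IsFiniteRel (cell I) A ∧ IsFiniteRel (cell I) B
  finite_right : ∀ ⦃A B : C⦄ (f : A ⟶ B), J f →
    IsFiniteRel (cell I) A ∧ IsFiniteRel (cell I) B

section Quillen

variable {C : Type u} [Category.{v} C] [ModelCategory C]
  {D : Type u'} [Category.{v'} D] [ModelCategory D]

/-- An adjunction `F ⊣ G` is a Quillen adjunction if `F` preserves cofibrations and trivial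
cofibrations. -/
structure IsQuillenAdjunction {F : C ⥤ D} {G : D ⥤ C} (_adj : F ⊣ G) : Prop where
  map_cofibrations : ∀ ⦃A B : C⦄ (f : A ⟶ B), cofibrations C f → cofibrations D (F.map f)
  map_trivialCofibrations : ∀ ⦃A B : C⦄ (f : A ⟶ B),
    trivialCofibrations C f → trivialCofibrations D (F.map f)

/-- A Quillen adjunction `F ⊣ G` is a Quillen equivalence if, for `X` cofibrant and `Y` fibrant,
a map `F X ⟶ Y` is a weak equivalence if and only if its adjoint `X ⟶ G Y` is. -/
structure IsQuillenEquivalence {F : C ⥤ D} {G : D ⥤ C} (adj : F ⊣ G) : Prop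
    extends IsQuillenAdjunction adj where
  weakEquivalence_iff : ∀ ⦃X : C⦄ ⦃Y : D⦄, IsCofibrant X → IsFibrant Y →
    ∀ f : F.obj X ⟶ Y, weakEquivalences D f ↔ weakEquivalences C (adj.homEquiv X Y f)

/-- A functor is a (left) Quillen equivalence if it has a right adjoint and the adjunction is a
Quillen equivalence (this does not depend on the choice of the right adjoint). -/
def IsLeftQuillenEquivalence (F : C ⥤ D) : Prop :=
  ∃ (G : D ⥤ C) (adj : F ⊣ G), IsQuillenEquivalence adj

end Quillen

end ModelStructure

set_option linter.unusedSectionVars false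

/-! ### Homotopies of maps defined on unit balls -/

namespace BallHomotopy

open Metric Set

section Glue

variable {Z X : Type*} [TopologicalSpace Z] [TopologicalSpace X]

lemma continuousOn_glue {A : Set Z} {f g : Z → X} {a b : Z → ℝ} (ha : Continuous a)
    (hb : Continuous b) (hf : ContinuousOn f (A ∩ {z | a z ≤ b z}))
    (hg : ContinuousOn g (A ∩ {z | b z ≤ a z})) (h : ∀ z ∈ A, a z = b z → f z = g z) :
    ContinuousOn (fun z => if a z ≤ b z then f z else g z) A := by
  have hA : A = (A ∩ {z | a z ≤ b z}) ∪ (A ∩ {z | b z ≤ a z}) := by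
    ext z
    simp only [mem_union, mem_inter_iff, mem_ofPred_eq]
    have := le_total (a z) (b z)
    tauto
  intro z hz
  rw [hA]
  refine ContinuousWithinAt.union ?_ ?_
  · by_cases h1 : a z ≤ b z
    · refine (hf z ⟨hz, h1⟩).congr (fun y hy => if_pos hy.2) (if_pos h1)
    · refine continuousWithinAt_of_notMem_closure fun h2 => h1 ?_
      exact closure_minimal inter_subset_right (isClosed_le ha hb) h2
  · by_cases h1 : b z ≤ a z
    · have key : ∀ y ∈ A, b y ≤ a y → (if a y ≤ b y then f y else g y) = g y := by
        intro y hy hy'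
        split_ifs with h3
        · exact h y hy (le_antisymm h3 hy')
        · rfl
      exact (hg z ⟨hz, h1⟩).congr (fun y hy => key y hy.1 hy.2) (key z hz h1)
    · refine continuousWithinAt_of_notMem_closure fun h2 => h1 ?_
      exact closure_minimal inter_subset_right (isClosed_le hb ha) h2

end Glue

/-- The closed unit ball. -/
abbrev unitBall (E : Type*) [NormedAddCommGroup E] : Set E := closedBall (0 : E) 1

/-- The unit sphere. -/
abbrev unitSphere (E : Type*) [NormedAddCommGroup E] : Set E := sphere (0 : E) 1

/-- The cylinder on the closed unit ball. -/
abbrev cylinder (E : Type*) [NormedAddCommGroup E] : Set (E × ℝ) := unitBall E ×ˢ Icc (0 : ℝ) 1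

section Defs

variable (E : Type*) [NormedAddCommGroup E] {X Y : Type*} [TopologicalSpace X]
  [TopologicalSpace Y]

/-- Homotopy of maps defined on the unit ball relative to the unit sphere. -/
def RelHomotopic (f g : E → X) : Prop :=
  ∃ H : E × ℝ → X, ContinuousOn H (cylinder E) ∧ (∀ x ∈ unitBall E, H (x, 0) = f x) ∧
    (∀ x ∈ unitBall E, H (x, 1) = g x) ∧
    ∀ x ∈ unitSphere E, ∀ t ∈ Icc (0 : ℝ) 1, H (x, t) = f x

/-- The right lifting property with respect to the inclusion of the unit sphere in the
unit ball. -/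
def SphereLifting (p : X → Y) : Prop :=
  ∀ (a : E → X) (b : E → Y), ContinuousOn a (unitSphere E) → ContinuousOn b (unitBall E) →
    (∀ x ∈ unitSphere E, p (a x) = b x) →
    ∃ h : E → X, ContinuousOn h (unitBall E) ∧ (∀ x ∈ unitSphere E, h x = a x) ∧
      ∀ x ∈ unitBall E, p (h x) = b x

/-- All extensions `b` of `p ∘ a` to the unit ball can be lifted up to relative homotopy to an
extension of `a`. -/
def Compressible (p : X → Y) (a : E → X) : Prop :=
  ∀ b : E → Y, ContinuousOn b (unitBall E) →
    (∀ x ∈ unitSphere E, p (a x) = b x) →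
    ∃ h : E → X, ContinuousOn h (unitBall E) ∧ (∀ x ∈ unitSphere E, h x = a x) ∧
      RelHomotopic E (p ∘ h) b

/-- The right lifting property up to relative homotopy with respect to the inclusion of the unit
sphere in the unit ball. -/
def Compression (p : X → Y) : Prop :=
  ∀ a : E → X, ContinuousOn a (unitSphere E) → Compressible E p a

/-- The homotopy lifting property with respect to the unit ball. -/
def HomotopyLifting (p : X → Y) : Prop :=
  ∀ (a : E → X) (H : E × ℝ → Y), ContinuousOn a (unitBall E) → ContinuousOn H (cylinder E) →
    (∀ x ∈ unitBall E, H (x, 0) = p (a x)) →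
    ∃ K : E × ℝ → X, ContinuousOn K (cylinder E) ∧ (∀ x ∈ unitBall E, K (x, 0) = a x) ∧
      ∀ z ∈ cylinder E, p (K z) = H z

/-- Injectivity of the map induced by `p` on homotopy classes of maps from the unit ball which are
constant on the unit sphere, at the class of the constant map. -/
def LoopInjective (p : X → Y) (x : X) : Prop :=
  ∀ a : E → X, ContinuousOn a (unitBall E) → (∀ z ∈ unitSphere E, a z = x) →
    RelHomotopic E (p ∘ a) (fun _ => p x) → RelHomotopic E a (fun _ => x)

/-- Surjectivity of the map induced by `p` on homotopy classes of maps from the unit ball which are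
constant on the unit sphere. -/
def LoopSurjective (p : X → Y) (x : X) : Prop :=
  ∀ b : E → Y, ContinuousOn b (unitBall E) → (∀ z ∈ unitSphere E, b z = p x) →
    ∃ a : E → X, ContinuousOn a (unitBall E) ∧ (∀ z ∈ unitSphere E, a z = x) ∧
      RelHomotopic E (p ∘ a) b

end Defs

section Transport

variable {E F : Type*} [NormedAddCommGroup E] [NormedAddCommGroup F]
  {X Y : Type*} [TopologicalSpace X] [TopologicalSpace Y]

lemma sphere_subset_ball : unitSphere E ⊆ unitBall E := sphere_subset_closedBall

lemma exists_norm_preserving_homeomorph [NormedSpace ℝ E] [NormedSpace ℝ F]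
    [FiniteDimensional ℝ E] [FiniteDimensional ℝ F]
    (h : Module.finrank ℝ E = Module.finrank ℝ F) : ∃ φ : E ≃ₜ F, ∀ x, ‖φ x‖ = ‖x‖ := by
  let e : E ≃L[ℝ] F := ContinuousLinearEquiv.ofFinrankEq h
  let s : Set F := e.symm ⁻¹' ball 0 1
  have hs : s = e '' ball 0 1 := (e.image_eq_preimage_symm _).symm
  have hsc : Convex ℝ s := (convex_ball (0 : E) 1).linear_preimage e.symm.toLinearMap
  have hs0 : s ∈ nhds 0 := e.symm.continuous.continuousAt.preimage_mem_nhds (by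
    simpa using ball_mem_nhds (0 : E) one_pos)
  have hsb : Bornology.IsVonNBounded ℝ s := by
    rw [hs]
    exact (NormedSpace.isVonNBounded_ball ℝ E 1).image e.toContinuousLinearMap
  have htb : Bornology.IsVonNBounded ℝ (ball (0 : F) 1) := NormedSpace.isVonNBounded_ball ℝ F 1
  have ht0 : ball (0 : F) 1 ∈ nhds 0 := ball_mem_nhds _ one_pos
  refine ⟨e.toHomeomorph.trans (gaugeRescaleHomeomorph s (ball 0 1) hsc hs0 hsb (convex_ball _ _)
    ht0 htb), fun x => ?_⟩
  have h1 := gauge_gaugeRescale s (absorbent_nhds_zero ht0) htb (e x)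
  rw [gauge_unit_ball] at h1
  refine h1.trans ?_
  have h2 : gauge s (e x) = gauge (ball (0 : E) 1) x := by
    simp only [gauge_def', s, mem_preimage, map_smul, e.symm_apply_apply]
  rw [h2, gauge_unit_ball]

variable (φ : E ≃ₜ F) (hφ : ∀ x, ‖φ x‖ = ‖x‖)

include hφ

lemma norm_symm (y : F) : ‖φ.symm y‖ = ‖y‖ := by
  rw [← hφ, φ.apply_symm_apply]

lemma mapsTo_ball : MapsTo φ (unitBall E) (unitBall F) := fun x hx => by
  simpa [hφ] using hx

lemma mapsTo_sphere : MapsTo φ (unitSphere E) (unitSphere F) := fun x hx => by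
  simpa [hφ] using hx

lemma RelHomotopic.comp_homeomorph {f g : F → X} (h : RelHomotopic F f g) :
    RelHomotopic E (f ∘ φ) (g ∘ φ) := by
  obtain ⟨H, h1, h2, h3, h4⟩ := h
  refine ⟨fun z => H (φ z.1, z.2), h1.comp (by fun_prop) ?_, fun x hx => h2 _ (mapsTo_ball φ hφ hx),
    fun x hx => h3 _ (mapsTo_ball φ hφ hx), fun x hx => h4 _ (mapsTo_sphere φ hφ hx)⟩
  exact fun z hz => ⟨mapsTo_ball φ hφ hz.1, hz.2⟩

lemma SphereLifting.of_homeomorph {p : X → Y} (h : SphereLifting E p) : SphereLifting F p := by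
  intro a b ha hb hab
  obtain ⟨k, h1, h2, h3⟩ := h (a ∘ φ) (b ∘ φ)
    (ha.comp φ.continuous.continuousOn (mapsTo_sphere φ hφ))
    (hb.comp φ.continuous.continuousOn (mapsTo_ball φ hφ))
    fun x hx => hab _ (mapsTo_sphere φ hφ hx)
  have m1 := mapsTo_ball φ.symm (norm_symm φ hφ)
  have m2 := mapsTo_sphere φ.symm (norm_symm φ hφ)
  refine ⟨k ∘ φ.symm, h1.comp φ.symm.continuous.continuousOn m1, fun x hx => ?_, fun x hx => ?_⟩
  · simpa using h2 _ (m2 hx)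
  · simpa using h3 _ (m1 hx)

lemma Compression.of_homeomorph {p : X → Y} (h : Compression E p) : Compression F p := by
  intro a ha b hb hab
  obtain ⟨k, h1, h2, h3⟩ := h (a ∘ φ)
    (ha.comp φ.continuous.continuousOn (mapsTo_sphere φ hφ)) (b ∘ φ)
    (hb.comp φ.continuous.continuousOn (mapsTo_ball φ hφ))
    fun x hx => hab _ (mapsTo_sphere φ hφ hx)
  have m1 := mapsTo_ball φ.symm (norm_symm φ hφ)
  have m2 := mapsTo_sphere φ.symm (norm_symm φ hφ)
  refine ⟨k ∘ φ.symm, h1.comp φ.symm.continuous.continuousOn m1, fun x hx => ?_, ?_⟩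
  · simpa using h2 _ (m2 hx)
  · have := h3.comp_homeomorph φ.symm (norm_symm φ hφ)
    rwa [Function.comp_assoc, Function.comp_assoc, φ.self_comp_symm, Function.comp_id] at this

lemma HomotopyLifting.of_homeomorph {p : X → Y} (h : HomotopyLifting E p) :
    HomotopyLifting F p := by
  intro a H ha hH haH
  obtain ⟨K, h1, h2, h3⟩ := h (a ∘ φ) (fun z => H (φ z.1, z.2))
    (ha.comp φ.continuous.continuousOn (mapsTo_ball φ hφ))
    (hH.comp (by fun_prop) fun z hz => ⟨mapsTo_ball φ hφ hz.1, hz.2⟩)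
    fun x hx => haH _ (mapsTo_ball φ hφ hx)
  have m1 := mapsTo_ball φ.symm (norm_symm φ hφ)
  refine ⟨fun z => K (φ.symm z.1, z.2), h1.comp (by fun_prop) fun z hz => ⟨m1 hz.1, hz.2⟩,
    fun x hx => ?_, fun z hz => ?_⟩
  · simpa using h2 _ (m1 hx)
  · simpa using h3 (φ.symm z.1, z.2) ⟨m1 hz.1, hz.2⟩

lemma LoopSurjective.of_homeomorph {p : X → Y} {x : X} (h : LoopSurjective E p x) :
    LoopSurjective F p x := by
  intro b hb hbx
  obtain ⟨k, h1, h2, h3⟩ := h (b ∘ φ)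
    (hb.comp φ.continuous.continuousOn (mapsTo_ball φ hφ))
    fun x hx => hbx _ (mapsTo_sphere φ hφ hx)
  have m1 := mapsTo_ball φ.symm (norm_symm φ hφ)
  have m2 := mapsTo_sphere φ.symm (norm_symm φ hφ)
  refine ⟨k ∘ φ.symm, h1.comp φ.symm.continuous.continuousOn m1, fun x hx => ?_, ?_⟩
  · simpa using h2 _ (m2 hx)
  · have := h3.comp_homeomorph φ.symm (norm_symm φ hφ)
    rwa [Function.comp_assoc, Function.comp_assoc, φ.self_comp_symm, Function.comp_id] at this

end Transport

section Extension

variable {E : Type*} [NormedAddCommGroup E] [NormedSpace ℝ E] {X Y : Type*} [TopologicalSpace X]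
  [TopologicalSpace Y]

/-- The homotopy extension property of the unit sphere in the unit ball. -/
lemma exists_homotopy_extension {b : E → Y} (hb : ContinuousOn b (unitBall E)) {a : E × ℝ → Y}
    (ha : ContinuousOn a (unitSphere E ×ˢ Icc (0 : ℝ) 1))
    (hab : ∀ x ∈ unitSphere E, a (x, 0) = b x) :
    ∃ G : E × ℝ → Y, ContinuousOn G (cylinder E) ∧ (∀ x ∈ unitBall E, G (x, 0) = b x) ∧
      ∀ x ∈ unitSphere E, ∀ t ∈ Icc (0 : ℝ) 1, G (x, t) = a (x, t) := by
  have pos : ∀ {z : E × ℝ}, z ∈ cylinder E → 0 < 2 - z.2 := fun hz => by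
    have := hz.2.2
    linarith
  refine ⟨fun z => if ‖z.1‖ ≤ (2 - z.2) / 2 then b ((2 / (2 - z.2)) • z.1) else
    a (‖z.1‖⁻¹ • z.1, 2 - (2 - z.2) / ‖z.1‖), ?_, ?_, ?_⟩
  · refine continuousOn_glue (by fun_prop) (by fun_prop) ?_ ?_ ?_
    · refine hb.comp (ContinuousOn.smul (ContinuousOn.div (by fun_prop) (by fun_prop)
        fun z hz => (pos hz.1).ne') (by fun_prop)) ?_
      rintro z ⟨hz, hz'⟩
      have h1 := pos hz
      have h2 : ‖z.1‖ ≤ (2 - z.2) / 2 := hz'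
      rw [mem_closedBall_zero_iff, norm_smul, Real.norm_of_nonneg (by positivity), div_mul_eq_mul_div,
        div_le_one h1]
      linarith
    · have hn : ∀ z ∈ cylinder E ∩ {z | (2 - z.2) / 2 ≤ ‖z.1‖}, ‖z.1‖ ≠ 0 := by
        rintro z ⟨hz, hz'⟩ h0
        have h1 := pos hz
        have h2 : (2 - z.2) / 2 ≤ ‖z.1‖ := hz'
        linarith
      refine ha.comp (ContinuousOn.prodMk (ContinuousOn.smul (ContinuousOn.inv₀ (by fun_prop) hn)
        (by fun_prop)) (ContinuousOn.sub (by fun_prop)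
        (ContinuousOn.div (by fun_prop) (by fun_prop) hn))) ?_
      rintro z ⟨hz, hz'⟩
      have h1 := hn z ⟨hz, hz'⟩
      have h2 : (2 - z.2) / 2 ≤ ‖z.1‖ := hz'
      have h3 : 0 < ‖z.1‖ := lt_of_le_of_ne (norm_nonneg _) h1.symm
      have h4 : ‖z.1‖ ≤ 1 := mem_closedBall_zero_iff.1 hz.1
      have h5 := hz.2.2
      refine ⟨?_, ?_, ?_⟩
      · simp [norm_smul, h1]
      · rw [sub_nonneg, div_le_iff₀ h3]
        linarith
      · rw [sub_le_comm, le_div_iff₀ h3]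
        linarith
    · intro z hz h
      have h1 := pos hz
      have h3 : ‖z.1‖⁻¹ = 2 / (2 - z.2) := by rw [h, inv_div]
      have h2 : 2 - (2 - z.2) / ‖z.1‖ = 0 := by
        rw [h]
        field_simp
        ring
      rw [h2, h3, hab]
      rw [← h3]
      have : ‖z.1‖ ≠ 0 := by rw [h]; positivity
      simp [norm_smul, this]
  · intro x hx
    have : ‖x‖ ≤ 1 := mem_closedBall_zero_iff.1 hx
    simp [this]
  · intro x hx t ht
    have h1 : ‖x‖ = 1 := mem_sphere_zero_iff_norm.1 hx
    simp only [h1, inv_one, one_smul, div_one, sub_sub_cancel]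
    split_ifs with h
    · have h2 : t = 0 := by
        have := ht.1
        linarith
      subst h2
      simp [hab x hx]
    · rfl

lemma mem_sphere_prod {z : E × ℝ} (hz : z ∈ unitSphere (E × ℝ)) :
    z.1 ∈ unitBall E ∧ z.2 ∈ Icc (-1 : ℝ) 1 ∧ (z.1 ∈ unitSphere E ∨ z.2 = -1 ∨ z.2 = 1) := by
  have h : max ‖z.1‖ ‖z.2‖ = 1 := mem_sphere_zero_iff_norm.1 hz
  rw [Real.norm_eq_abs] at h
  have h1 : ‖z.1‖ ≤ 1 := h ▸ le_max_left _ _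
  have h2 : |z.2| ≤ 1 := h ▸ le_max_right _ _
  refine ⟨mem_closedBall_zero_iff.2 h1, abs_le.1 h2, ?_⟩
  rcases max_choice ‖z.1‖ |z.2| with h3 | h3
  · left
    rw [mem_sphere_zero_iff_norm, ← h3, h]
  · right
    have : |z.2| = 1 := h3 ▸ h
    rcases abs_choice z.2 with h4 | h4 <;> rw [h4] at this
    · exact Or.inr this
    · exact Or.inl (by linarith)

lemma mem_ball_prod {z : E × ℝ} :
    z ∈ unitBall (E × ℝ) ↔ z.1 ∈ unitBall E ∧ z.2 ∈ Icc (-1 : ℝ) 1 := by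
  rw [mem_closedBall_zero_iff, mem_closedBall_zero_iff, Prod.norm_def, max_le_iff,
    Real.norm_eq_abs, abs_le, mem_Icc]

lemma mk_mem_sphere_left {x : E} (hx : x ∈ unitSphere E) {s : ℝ} (hs : s ∈ Icc (-1 : ℝ) 1) :
    (x, s) ∈ unitSphere (E × ℝ) := by
  have h1 : ‖x‖ = 1 := mem_sphere_zero_iff_norm.1 hx
  rw [mem_sphere_zero_iff_norm, Prod.norm_def, h1, max_eq_left]
  exact abs_le.2 hs

lemma mk_mem_sphere_right {x : E} (hx : x ∈ unitBall E) {s : ℝ} (hs : |s| = 1) :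
    (x, s) ∈ unitSphere (E × ℝ) := by
  have h1 : ‖x‖ ≤ 1 := mem_closedBall_zero_iff.1 hx
  rw [mem_sphere_zero_iff_norm, Prod.norm_def, Real.norm_eq_abs, hs, max_eq_right h1]

/-- Two maps on the unit ball which agree on the unit sphere define a map on the boundary of the
cylinder. -/
lemma continuousOn_cylinder_boundary {f g : E → X} (hf : ContinuousOn f (unitBall E))
    (hg : ContinuousOn g (unitBall E)) (hfg : ∀ x ∈ unitSphere E, f x = g x) :
    ContinuousOn (fun z : E × ℝ => if z.2 ≤ 0 then f z.1 else g z.1) (unitSphere (E × ℝ)) := by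
  refine continuousOn_glue (by fun_prop) (by fun_prop) (hf.comp (by fun_prop) ?_)
    (hg.comp (by fun_prop) ?_) ?_
  · exact fun z hz => (mem_sphere_prod hz.1).1
  · exact fun z hz => (mem_sphere_prod hz.1).1
  · intro z hz h0
    rcases (mem_sphere_prod hz).2.2 with h | h | h
    · exact hfg _ h
    · linarith
    · linarith

lemma continuousOn_reparam {H : E × ℝ → X} (hH : ContinuousOn H (cylinder E)) :
    ContinuousOn (fun z : E × ℝ => H (z.1, (z.2 + 1) / 2)) (unitBall (E × ℝ)) := by
  refine hH.comp (by fun_prop) fun z hz => ?_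
  rw [mem_ball_prod] at hz
  obtain ⟨h1, h2, h3⟩ := hz
  exact ⟨h1, by simp only; constructor <;> linarith⟩

lemma continuousOn_reparam_symm {H : E × ℝ → X} (hH : ContinuousOn H (unitBall (E × ℝ))) :
    ContinuousOn (fun z : E × ℝ => H (z.1, 2 * z.2 - 1)) (cylinder E) := by
  refine hH.comp (by fun_prop) fun z hz => ?_
  rw [mem_ball_prod]
  obtain ⟨h1, h2, h3⟩ := hz
  exact ⟨h1, by simp only; constructor <;> linarith⟩

/-- A common statement for lifting a relative homotopy. -/
lemma cylinder_boundary_compatible {p : X → Y} {f g : E → X}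
    {H : E × ℝ → Y} (hH0 : ∀ x ∈ unitBall E, H (x, 0) = p (f x))
    (hH1 : ∀ x ∈ unitBall E, H (x, 1) = p (g x))
    (hH : ∀ x ∈ unitSphere E, ∀ t ∈ Icc (0 : ℝ) 1, H (x, t) = p (f x))
    (hfg : ∀ x ∈ unitSphere E, f x = g x) (z : E × ℝ) (hz : z ∈ unitSphere (E × ℝ)) :
    p (if z.2 ≤ 0 then f z.1 else g z.1) = H (z.1, (z.2 + 1) / 2) := by
  obtain ⟨h1, ⟨h2, h2'⟩, h3 | h3 | h3⟩ := mem_sphere_prod hz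
  · rw [hH _ h3 _ (by constructor <;> linarith)]
    split_ifs
    · rfl
    · rw [hfg _ h3]
  · rw [h3, if_pos (by norm_num), ← hH0 _ h1]
    norm_num
  · rw [h3, if_neg (by norm_num), ← hH1 _ h1]
    norm_num

lemma cylinder_boundary_eval {f g : E → X} (hfg : ∀ x ∈ unitSphere E, f x = g x)
    {K : E × ℝ → X}
    (hK : ∀ z ∈ unitSphere (E × ℝ), K z = if z.2 ≤ 0 then f z.1 else g z.1) :
    (∀ x ∈ unitBall E, K (x, 2 * 0 - 1) = f x) ∧ (∀ x ∈ unitBall E, K (x, 2 * 1 - 1) = g x) ∧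
      ∀ x ∈ unitSphere E, ∀ t ∈ Icc (0 : ℝ) 1, K (x, 2 * t - 1) = f x := by
  refine ⟨fun x hx => ?_, fun x hx => ?_, fun x hx t ht => ?_⟩
  · rw [hK _ (mk_mem_sphere_right hx (by norm_num))]
    norm_num
  · rw [hK _ (mk_mem_sphere_right hx (by norm_num))]
    norm_num
  · rw [hK _ (mk_mem_sphere_left hx ⟨by linarith [ht.1], by linarith [ht.2]⟩)]
    split_ifs
    · rfl
    · exact (hfg x hx).symm

lemma SphereLifting.lift_homotopy {p : X → Y} (hp : SphereLifting (E × ℝ) p) {f g : E → X}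
    (hf : ContinuousOn f (unitBall E)) (hg : ContinuousOn g (unitBall E))
    (hfg : ∀ x ∈ unitSphere E, f x = g x) {H : E × ℝ → Y} (hHc : ContinuousOn H (cylinder E))
    (hH0 : ∀ x ∈ unitBall E, H (x, 0) = p (f x)) (hH1 : ∀ x ∈ unitBall E, H (x, 1) = p (g x))
    (hH : ∀ x ∈ unitSphere E, ∀ t ∈ Icc (0 : ℝ) 1, H (x, t) = p (f x)) :
    ∃ K : E × ℝ → X, ContinuousOn K (cylinder E) ∧ (∀ x ∈ unitBall E, K (x, 0) = f x) ∧
      (∀ x ∈ unitBall E, K (x, 1) = g x) ∧ ∀ z ∈ cylinder E, p (K z) = H z := by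
  obtain ⟨K, h1, h2, h3⟩ := hp _ _ (continuousOn_cylinder_boundary hf hg hfg)
    (continuousOn_reparam hHc) (cylinder_boundary_compatible hH0 hH1 hH hfg)
  obtain ⟨h4, h5, -⟩ := cylinder_boundary_eval hfg h2
  refine ⟨fun z => K (z.1, 2 * z.2 - 1), continuousOn_reparam_symm h1, h4, h5, fun z hz => ?_⟩
  rw [h3]
  · norm_num
  · rw [mem_ball_prod]
    exact ⟨hz.1, by simp only; constructor <;> linarith [hz.2.1, hz.2.2]⟩

lemma Compression.relHomotopic {p : X → Y} (hp : Compression (E × ℝ) p) {f g : E → X}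
    (hf : ContinuousOn f (unitBall E)) (hg : ContinuousOn g (unitBall E))
    (hfg : ∀ x ∈ unitSphere E, f x = g x) (h : RelHomotopic E (p ∘ f) (p ∘ g)) :
    RelHomotopic E f g := by
  obtain ⟨H, hHc, hH0, hH1, hH⟩ := h
  obtain ⟨K, h1, h2, -⟩ := hp _ (continuousOn_cylinder_boundary hf hg hfg) _
    (continuousOn_reparam hHc) (cylinder_boundary_compatible hH0 hH1 hH hfg)
  exact ⟨fun z => K (z.1, 2 * z.2 - 1), continuousOn_reparam_symm h1, cylinder_boundary_eval hfg h2⟩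

lemma RelHomotopic.of_eqOn {f g : E → X} (hf : ContinuousOn f (unitBall E))
    (h : ∀ x ∈ unitBall E, f x = g x) : RelHomotopic E f g :=
  ⟨fun z => f z.1, hf.comp (by fun_prop) fun _ hz => hz.1, fun _ _ => rfl, h, fun _ _ _ _ => rfl⟩

lemma SphereLifting.compression {p : X → Y} (hpc : Continuous p) (hp : SphereLifting E p) :
    Compression E p := by
  intro a ha b hb hab
  obtain ⟨h, h1, h2, h3⟩ := hp a b ha hb hab
  exact ⟨h, h1, h2, RelHomotopic.of_eqOn (hpc.comp_continuousOn h1) h3⟩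

lemma Compressible.congr {p : X → Y} {a a' : E → X} (h : Compressible E p a)
    (haa' : ∀ x ∈ unitSphere E, a x = a' x) : Compressible E p a' := by
  intro b hb hab
  obtain ⟨k, h1, h2, h3⟩ := h b hb fun x hx => by rw [haa' x hx, hab x hx]
  exact ⟨k, h1, fun x hx => (h2 x hx).trans (haa' x hx), h3⟩

end Extension

end BallHomotopy

namespace BallHomotopy

open Metric Set

variable {E : Type*} [NormedAddCommGroup E] [NormedSpace ℝ E] {X Y : Type*} [TopologicalSpace X]
  [TopologicalSpace Y]

/-! ### Homotopy lifting and sphere lifting -/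

/-- The radial retraction on the closed unit ball. -/
noncomputable def radialRetraction (x : E) : E := (max 1 ‖x‖)⁻¹ • x

lemma continuous_radialRetraction : Continuous (radialRetraction : E → E) :=
  Continuous.smul (Continuous.inv₀ (continuous_const.max continuous_norm) fun _ =>
    (lt_of_lt_of_le one_pos (le_max_left _ _)).ne') continuous_id

lemma radialRetraction_mem (x : E) : radialRetraction x ∈ unitBall E := by
  have h1 : (0 : ℝ) < max 1 ‖x‖ := lt_of_lt_of_le one_pos (le_max_left _ _)
  rw [mem_closedBall_zero_iff, radialRetraction, norm_smul, norm_inv, Real.norm_of_nonneg h1.le,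
    inv_mul_le_iff₀ h1, mul_one]
  exact le_max_right _ _

lemma radialRetraction_eq {x : E} (hx : x ∈ unitBall E) : radialRetraction x = x := by
  have : ‖x‖ ≤ 1 := mem_closedBall_zero_iff.1 hx
  simp [radialRetraction, max_eq_left this]

lemma SphereLifting.homotopyLifting {p : X → Y} (hp : SphereLifting E p)
    (hp' : SphereLifting (E × ℝ) p) : HomotopyLifting E p := by
  intro a H ha hH haH
  let ρ : E → E := fun x => radialRetraction ((2 : ℝ) • x)
  have hρ : Continuous ρ := continuous_radialRetraction.comp (by fun_prop)
  let τ : E × ℝ → ℝ := fun z => z.2 * max 0 (min 1 (2 - 2 * ‖z.1‖))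
  have hτ : Continuous τ := by fun_prop
  have hτ' : ∀ z ∈ cylinder E, τ z ∈ Icc (0 : ℝ) 1 := by
    rintro z ⟨-, h1, h2⟩
    exact ⟨by positivity, mul_le_one₀ h2 (by positivity) (max_le zero_le_one (min_le_left _ _))⟩
  have ha' : ContinuousOn (fun x => a (ρ x)) (unitBall E) :=
    ha.comp hρ.continuousOn fun x _ => radialRetraction_mem _
  have hH' : ContinuousOn (fun z : E × ℝ => H (ρ z.1, τ z)) (cylinder E) :=
    hH.comp (by fun_prop) fun z hz => ⟨radialRetraction_mem _, hτ' z hz⟩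
  have hS : ∀ x ∈ unitSphere E, ∀ t, H (ρ x, τ (x, t)) = p (a (ρ x)) := by
    intro x hx t
    have h0 : τ (x, t) = 0 := by
      have : ‖x‖ = 1 := mem_sphere_zero_iff_norm.1 hx
      simp [τ, this]
    rw [h0, haH _ (radialRetraction_mem _)]
  obtain ⟨d, hd, hda, hdH⟩ := hp (fun x => a (ρ x)) (fun x => H (ρ x, τ (x, 1)))
    (ha'.mono sphere_subset_ball)
    (hH'.comp (f := fun x : E => (x, (1 : ℝ))) (by fun_prop) fun x hx => ⟨hx, by simp⟩)
    fun x hx => (hS x hx 1).symm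
  obtain ⟨K, hK, hK0, -, hKH⟩ := hp'.lift_homotopy ha' hd (fun x hx => (hda x hx).symm) hH'
    (fun x _ => by
      have : τ (x, 0) = 0 := by simp [τ]
      simp only [this]
      exact haH _ (radialRetraction_mem _))
    (fun x hx => (hdH x hx).symm)
    (fun x hx t _ => hS x hx t)
  have hhalf : ∀ x ∈ unitBall E, (2 : ℝ)⁻¹ • x ∈ unitBall E := by
    intro x hx
    have : ‖x‖ ≤ 1 := mem_closedBall_zero_iff.1 hx
    rw [mem_closedBall_zero_iff, norm_smul]
    norm_num
    linarith
  have hρ' : ∀ x ∈ unitBall E, ρ ((2 : ℝ)⁻¹ • x) = x := by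
    intro x hx
    simp only [ρ]
    rw [smul_smul, mul_inv_cancel₀ two_ne_zero, one_smul, radialRetraction_eq hx]
  refine ⟨fun z => K ((2 : ℝ)⁻¹ • z.1, z.2), hK.comp (by fun_prop)
    fun z hz => ⟨hhalf _ hz.1, hz.2⟩, fun x hx => ?_, fun z hz => ?_⟩
  · simp only [hK0 _ (hhalf x hx), hρ' x hx]
  · simp only
    rw [hKH ((2 : ℝ)⁻¹ • z.1, z.2) ⟨hhalf _ hz.1, hz.2⟩]
    simp only [hρ' _ hz.1]
    congr 1
    refine Prod.ext rfl ?_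
    have : ‖z.1‖ ≤ 1 := mem_closedBall_zero_iff.1 hz.1
    have h2 : (1 : ℝ) ≤ 2 - 2 * ‖(2 : ℝ)⁻¹ • z.1‖ := by
      rw [norm_smul]
      norm_num
      linarith
    simp [τ, min_eq_left h2]

/-- The homotopy lifting property relatively to the unit sphere. -/
lemma HomotopyLifting.relative {p : X → Y} (hp : HomotopyLifting (E × ℝ) p) {g H : E × ℝ → _}
    (hg : ContinuousOn g (unitSphere E ×ˢ Icc (0 : ℝ) 1 ∪ unitBall E ×ˢ {0}))
    (hH : ContinuousOn H (cylinder E))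
    (hgH : ∀ z ∈ unitSphere E ×ˢ Icc (0 : ℝ) 1 ∪ unitBall E ×ˢ {0}, p (g z) = H z) :
    ∃ K : E × ℝ → X, ContinuousOn K (cylinder E) ∧
      (∀ z ∈ unitSphere E ×ˢ Icc (0 : ℝ) 1 ∪ unitBall E ×ˢ {0}, K z = g z) ∧
      ∀ z ∈ cylinder E, p (K z) = H z := by
  let s : E × ℝ → ℝ := fun z => max ‖z.1‖ ((2 - z.2) / 2)
  have hs : Continuous s := by fun_prop
  let c : (E × ℝ) × ℝ → ℝ := fun w => max ((1 - w.2) / s w.1) 1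
  let D : (E × ℝ) × ℝ → E × ℝ := fun w => (c w • w.1.1, 2 - c w * (2 - w.1.2))
  have s_pos : ∀ {z}, z ∈ cylinder E → 0 < s z := by
    rintro z ⟨-, -, h⟩
    exact lt_max_of_lt_right (by linarith)
  have s_half : ∀ {z}, z ∈ cylinder E → 1 / 2 ≤ s z := by
    rintro z ⟨-, -, h⟩
    exact le_max_of_le_right (by linarith)
  have s_le : ∀ {z}, z ∈ cylinder E → s z ≤ 1 := by
    rintro z ⟨h1, h2, -⟩
    exact max_le (mem_closedBall_zero_iff.1 h1) (by linarith)
  have hD : ContinuousOn D (cylinder E ×ˢ Icc (0 : ℝ) 1) := by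
    have hc : ContinuousOn c (cylinder E ×ˢ Icc (0 : ℝ) 1) :=
      ContinuousOn.sup (ContinuousOn.div (by fun_prop) (by fun_prop)
        fun w hw => (s_pos hw.1).ne') continuousOn_const
    fun_prop
  have hDc : ∀ {w}, w ∈ cylinder E ×ˢ Icc (0 : ℝ) 1 → D w ∈ cylinder E := by
    rintro ⟨⟨x, t⟩, τ⟩ ⟨hz, hτ0, hτ1⟩
    have h0 := s_pos hz
    have h1 : 1 ≤ c ((x, t), τ) := le_max_right _ _
    have h2 : c ((x, t), τ) * s (x, t) ≤ 1 := by
      rw [← le_div_iff₀ h0]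
      refine max_le (by gcongr; simp only at hτ0; linarith) ?_
      rw [le_div_iff₀ h0, one_mul]
      exact s_le hz
    have h3 : ‖x‖ ≤ s (x, t) := le_max_left _ _
    have h4 : (2 - t) / 2 ≤ s (x, t) := le_max_right _ _
    obtain ⟨-, h5, h6⟩ := hz
    simp only at h5 h6
    refine ⟨?_, ?_, ?_⟩
    · rw [mem_closedBall_zero_iff]
      simp only [D]
      rw [norm_smul, Real.norm_of_nonneg (by positivity)]
      exact (mul_le_mul_of_nonneg_left h3 (by positivity)).trans h2
    · simp only [D]
      have := mul_le_mul_of_nonneg_left h4 (show 0 ≤ c ((x, t), τ) by positivity)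
      linarith
    · simp only [D]
      nlinarith
  have hD0 : ∀ {z}, z ∈ cylinder E →
      D (z, 0) ∈ unitSphere E ×ˢ Icc (0 : ℝ) 1 ∪ unitBall E ×ˢ {0} := by
    rintro ⟨x, t⟩ hz
    have h0 := s_pos hz
    have h7 := hDc (w := ((x, t), 0)) ⟨hz, by simp⟩
    have hc : c ((x, t), 0) = (s (x, t))⁻¹ := by
      simp only [c, sub_zero, one_div]
      exact max_eq_left ((one_le_inv₀ h0).2 (s_le hz))
    rcases max_choice ‖x‖ ((2 - t) / 2) with h | h
    · left
      refine ⟨?_, h7.2⟩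
      have h8 : s (x, t) = ‖x‖ := h
      rw [mem_sphere_zero_iff_norm]
      simp only [D]
      rw [norm_smul, hc, norm_inv, Real.norm_of_nonneg h0.le, h8, inv_mul_cancel₀ (h8 ▸ h0.ne')]
    · right
      refine ⟨h7.1, ?_⟩
      have h8 : s (x, t) = (2 - t) / 2 := h
      have h9 : 2 - t ≠ 0 := by
        rw [h8] at h0
        linarith
      simp only [D, hc, h8, mem_singleton_iff]
      field_simp
      ring
  have hDA : ∀ z ∈ unitSphere E ×ˢ Icc (0 : ℝ) 1 ∪ unitBall E ×ˢ {0},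
      z ∈ cylinder E ∧ s z = 1 := by
    rintro ⟨x, t⟩ (⟨h1, h2⟩ | ⟨h1, h2⟩)
    · have h3 : ‖x‖ = 1 := mem_sphere_zero_iff_norm.1 h1
      refine ⟨⟨sphere_subset_ball h1, h2⟩, ?_⟩
      simp only [s, h3]
      exact max_eq_left (by linarith [h2.1])
    · simp only [mem_singleton_iff] at h2
      subst h2
      refine ⟨⟨h1, by simp⟩, ?_⟩
      have h3 : ‖x‖ ≤ 1 := mem_closedBall_zero_iff.1 h1
      simp [s, h3]
  have hDs : ∀ z ∈ cylinder E, D (z, 1 - s z) = z := by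
    rintro ⟨x, t⟩ hz
    have h0 := s_pos hz
    have : c ((x, t), 1 - s (x, t)) = 1 := by
      simp [c, h0.ne']
    simp [D, this]
  obtain ⟨K, hK, hKg, hKH⟩ := hp (fun z => g (D ((z.1, (z.2 + 1) / 2), 0)))
    (fun w => H (D ((w.1.1, (w.1.2 + 1) / 2), w.2)))
    (hg.comp (hD.comp (by fun_prop) fun z hz => by
        rw [mem_ball_prod] at hz
        obtain ⟨h1, h2, h3⟩ := hz
        exact ⟨⟨h1, by simp only; constructor <;> linarith⟩, by simp⟩) fun z hz => by
      rw [mem_ball_prod] at hz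
      obtain ⟨h1, h2, h3⟩ := hz
      exact hD0 ⟨h1, by simp only; constructor <;> linarith⟩)
    (hH.comp (hD.comp (by fun_prop) fun z hz => by
        obtain ⟨hz, h4⟩ := hz
        rw [mem_ball_prod] at hz
        obtain ⟨h1, h2, h3⟩ := hz
        exact ⟨⟨h1, by simp only; constructor <;> linarith⟩, h4⟩) fun z hz => by
      obtain ⟨hz, h4⟩ := hz
      rw [mem_ball_prod] at hz
      obtain ⟨h1, h2, h3⟩ := hz
      exact hDc ⟨⟨h1, by simp only; constructor <;> linarith⟩, h4⟩)
    fun z hz => by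
      rw [mem_ball_prod] at hz
      obtain ⟨h1, h2, h3⟩ := hz
      exact (hgH _ (hD0 (z := (z.1, (z.2 + 1) / 2)) ⟨h1, by constructor <;> linarith⟩)).symm
  have hmem : ∀ z ∈ cylinder E, ((z.1, 2 * z.2 - 1), 1 - s z) ∈ cylinder (E × ℝ) := by
    intro z hz
    refine ⟨?_, by linarith [s_le hz], by linarith [s_pos hz]⟩
    rw [mem_ball_prod]
    exact ⟨hz.1, by simp only; constructor <;> linarith [hz.2.1, hz.2.2]⟩
  refine ⟨fun z => K ((z.1, 2 * z.2 - 1), 1 - s z), hK.comp (by fun_prop) hmem, fun z hz => ?_,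
    fun z hz => ?_⟩
  · obtain ⟨h1, h2⟩ := hDA z hz
    have h3 := hDs z h1
    rw [h2, sub_self] at h3
    have h4 := (hmem z h1).1
    simp only [h2, sub_self]
    rw [hKg _ h4]
    simp only [sub_add_cancel, mul_div_cancel_left₀ _ (two_ne_zero' ℝ)]
    rw [h3]
  · simp only
    rw [hKH _ (hmem z hz)]
    simp only [sub_add_cancel, mul_div_cancel_left₀ _ (two_ne_zero' ℝ)]
    rw [hDs z hz]

lemma Compression.sphereLifting {p : X → Y} (hp : Compression E p)
    (hp' : HomotopyLifting (E × ℝ) p) : SphereLifting E p := by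
  intro a b ha hb hab
  obtain ⟨h, h1, h2, H, hHc, hH0, hH1, hH⟩ := hp a ha b hb hab
  obtain ⟨K, hK, hKg, hKH⟩ := hp'.relative (g := fun z => h z.1)
    (h1.comp (by fun_prop) (by
      rintro z (hz | hz)
      · exact sphere_subset_ball hz.1
      · exact hz.1)) hHc (by
      rintro ⟨x, t⟩ (⟨hx, ht⟩ | ⟨hx, ht⟩)
      · exact (hH x hx t ht).symm
      · simp only [mem_singleton_iff] at ht
        subst ht
        exact (hH0 x hx).symm)
  refine ⟨fun x => K (x, 1), hK.comp (by fun_prop) fun x hx => ⟨hx, by simp⟩, fun x hx => ?_,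
    fun x hx => ?_⟩
  · rw [← h2 x hx]
    exact hKg _ (Or.inl ⟨hx, by simp⟩)
  · rw [hKH _ ⟨hx, by simp⟩, hH1 x hx]

/-! ### Compression of homotopic maps -/

lemma Compressible.of_homotopy {f : X → Y} (hf : Continuous f) {a : E × ℝ → X}
    (ha : ContinuousOn a (unitSphere E ×ˢ Icc (0 : ℝ) 1))
    (h : Compressible E f fun x => a (x, 1)) : Compressible E f fun x => a (x, 0) := by
  intro b hb hab
  obtain ⟨B, hB, hB0, hBa⟩ := exists_homotopy_extension hb (hf.comp_continuousOn ha) hab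
  obtain ⟨k, hk, hka, G, hG, hG0, hG1, hGS⟩ := h (fun x => B (x, 1))
    (hB.comp (by fun_prop) fun x hx => ⟨hx, by simp⟩) fun x hx => (hBa x hx 1 (by simp)).symm
  obtain ⟨A, hA, hA0, hAa⟩ := exists_homotopy_extension (a := fun z => a (z.1, 1 - z.2)) hk
    (ha.comp (by fun_prop) fun z hz => ⟨hz.1, by simp only; constructor <;> linarith [hz.2.1, hz.2.2]⟩)
    fun x hx => by simp [hka x hx]
  have hI : ∀ {t : ℝ}, t ∈ Icc (0 : ℝ) 1 → 1 - t ∈ Icc (0 : ℝ) 1 := fun ht =>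
    ⟨by linarith [ht.2], by linarith [ht.1]⟩
  have hS : ∀ x ∈ unitSphere E, ∀ t ∈ Icc (0 : ℝ) 1, f (A (x, t)) = B (x, 1 - t) := by
    intro x hx t ht
    rw [hAa x hx t ht, hBa x hx _ (hI ht)]
    rfl
  obtain ⟨K, hK, hK0, hKS⟩ := exists_homotopy_extension (E := E × ℝ)
    (b := fun z => G (z.1, (z.2 + 1) / 2))
    (a := fun w => if w.1.2 ≤ 0 then f (A (w.1.1, w.2)) else B (w.1.1, 1 - w.2))
    (continuousOn_reparam hG) (by
      refine continuousOn_glue (by fun_prop) (by fun_prop)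
        (hf.comp_continuousOn (hA.comp (by fun_prop) ?_)) (hB.comp (by fun_prop) ?_) ?_
      · exact fun w hw => ⟨(mem_sphere_prod hw.1.1).1, hw.1.2⟩
      · exact fun w hw => ⟨(mem_sphere_prod hw.1.1).1, hI hw.1.2⟩
      · intro w hw h0
        rcases (mem_sphere_prod hw.1).2.2 with h | h | h
        · exact hS _ h _ hw.2
        · linarith
        · linarith) (by
      rintro ⟨x, s⟩ hz
      obtain ⟨h1, ⟨h2, h2'⟩, h3 | h3 | h3⟩ := mem_sphere_prod hz
      · simp only at h1 h2 h2' h3 ⊢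
        rw [hGS _ h3 _ (by constructor <;> linarith), sub_zero, hBa _ h3 _ (by simp), hA0 _ h1,
          Function.comp_apply]
        simp [hka _ h3]
      · simp only at h1 h3 ⊢
        rw [h3, if_pos (by norm_num), hA0 _ h1]
        norm_num
        exact (hG0 _ h1).symm
      · simp only at h1 h3 ⊢
        rw [h3, if_neg (by norm_num)]
        norm_num
        exact (hG1 _ h1).symm)
  refine ⟨fun x => A (x, 1), hA.comp (by fun_prop) fun x hx => ⟨hx, by simp⟩, fun x hx => ?_,
    fun z => K ((z.1, 2 * z.2 - 1), 1), ?_, fun x hx => ?_, fun x hx => ?_, fun x hx t ht => ?_⟩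
  · simp only
    rw [hAa x hx 1 (by simp)]
    simp
  · refine (continuousOn_reparam_symm (H := fun z => K (z, 1)) ?_)
    exact hK.comp (by fun_prop) fun x hx => ⟨hx, by simp⟩
  · simp only
    rw [hKS _ (mk_mem_sphere_right hx (by norm_num)) _ (by simp), if_pos (by norm_num)]
    rfl
  · simp only
    rw [hKS _ (mk_mem_sphere_right hx (by norm_num)) _ (by simp), if_neg (by norm_num), sub_self,
      hB0 x hx]
  · simp only [Function.comp_apply]
    rw [hKS _ (mk_mem_sphere_left hx ⟨by linarith [ht.1], by linarith [ht.2]⟩) _ (by simp)]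
    split_ifs
    · rfl
    · rw [hS x hx 1 (by simp)]

/-! ### Compression from the injectivity and surjectivity on homotopy classes of loops -/

/-- An auxiliary vector for the definition of `collapse`. -/
def collapseVector (w : (E × ℝ) × ℝ) : E × ℝ :=
  (((1 - w.2) + w.2 * ((1 - ‖w.1.1‖) * max w.1.2 0)) • w.1.1, w.1.2 - 2 * w.2 * ‖w.1.1‖)

/-- A homotopy on the boundary of a cylinder from the identity to a map which collapses the
complement of the top face. -/
noncomputable def collapse (w : (E × ℝ) × ℝ) : E × ℝ :=
  ‖collapseVector w‖⁻¹ • collapseVector w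

/-- The south pole of the boundary of the cylinder. -/
abbrev southPole (E : Type*) [NormedAddCommGroup E] : E × ℝ := (0, -1)

lemma collapse_ne_zero {w : (E × ℝ) × ℝ} (hw : w ∈ unitSphere (E × ℝ) ×ˢ Icc (0 : ℝ) 1) :
    collapseVector w ≠ 0 := by
  obtain ⟨⟨x, h⟩, t⟩ := w
  obtain ⟨hz, ht0, ht1⟩ := hw
  obtain ⟨h1, ⟨h2, h3⟩, h4⟩ := mem_sphere_prod hz
  simp only [mem_sphere_zero_iff_norm, mem_closedBall_zero_iff] at *
  intro h0
  rw [collapseVector, Prod.mk_eq_zero, smul_eq_zero] at h0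
  obtain ⟨h5 | h5, h6⟩ := h0
  · have h7 : 0 ≤ t * ((1 - ‖x‖) * max h 0) :=
      mul_nonneg ht0 (mul_nonneg (by linarith) (le_max_right _ _))
    have h8 : t = 1 := by linarith
    subst h8
    have h9 : (1 - ‖x‖) * max h 0 = 0 := by linarith
    rcases mul_eq_zero.1 h9 with h10 | h10
    · linarith
    · have h11 : h ≤ 0 := by
        rw [← h10]
        exact le_max_left _ _
      have := norm_nonneg x
      rcases h4 with h4 | h4 | h4 <;> linarith
  · subst h5
    simp only [norm_zero, mul_zero, sub_zero] at *
    subst h6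
    norm_num at h4

lemma continuousOn_collapse :
    ContinuousOn (collapse : (E × ℝ) × ℝ → E × ℝ) (unitSphere (E × ℝ) ×ˢ Icc (0 : ℝ) 1) := by
  have h : Continuous (collapseVector : (E × ℝ) × ℝ → E × ℝ) := by
    unfold collapseVector
    fun_prop
  refine ContinuousOn.smul (ContinuousOn.inv₀ h.norm.continuousOn fun w hw => ?_) h.continuousOn
  exact norm_ne_zero_iff.2 (collapse_ne_zero hw)

lemma collapse_mem {w : (E × ℝ) × ℝ} (hw : w ∈ unitSphere (E × ℝ) ×ˢ Icc (0 : ℝ) 1) :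
    collapse w ∈ unitSphere (E × ℝ) := by
  rw [mem_sphere_zero_iff_norm, collapse]
  rw [norm_smul, norm_inv, norm_norm]
  exact inv_mul_cancel₀ (norm_ne_zero_iff.2 (collapse_ne_zero hw))

lemma collapse_zero {z : E × ℝ} (hz : z ∈ unitSphere (E × ℝ)) : collapse (z, 0) = z := by
  have : ‖z‖ = 1 := mem_sphere_zero_iff_norm.1 hz
  simp [collapse, collapseVector, this]

lemma collapse_one {z : E × ℝ} (hz : z ∈ unitSphere (E × ℝ)) (h : z.1 ∈ unitSphere E ∨ z.2 ≤ 0) :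
    collapse (z, 1) = southPole E := by
  obtain ⟨x, s⟩ := z
  obtain ⟨h1, ⟨h2, h3⟩, h4⟩ := mem_sphere_prod hz
  have hm : (1 - ‖x‖) * max s 0 = 0 := by
    rcases h with h | h
    · have : ‖x‖ = 1 := mem_sphere_zero_iff_norm.1 h
      simp [this]
    · simp only at h
      simp [max_eq_right h]
  have hneg : s - 2 * ‖x‖ < 0 := by
    have := norm_nonneg x
    have hS : x ∈ unitSphere E → s - 2 * ‖x‖ < 0 := fun h => by
      have : ‖x‖ = 1 := mem_sphere_zero_iff_norm.1 h
      simp only at h3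
      linarith
    rcases h with h | h
    · exact hS h
    · rcases h4 with h4 | h4 | h4
      · exact hS h4
      · simp only at h4
        linarith
      · simp only at h4 h
        linarith
  have hn : ‖s - 2 * ‖x‖‖ = -(s - 2 * ‖x‖) := by
    rw [Real.norm_eq_abs, abs_of_neg hneg]
  simp only [collapse, collapseVector, sub_self, one_mul, mul_one, hm, add_zero, zero_smul, Prod.norm_mk,
    norm_zero, hn, Prod.smul_mk, smul_zero, smul_eq_mul]
  rw [max_eq_right (by linarith)]
  refine Prod.ext rfl ?_
  simp only
  have := hneg.ne
  field_simp

lemma compressible_of_loop {f : X → Y} (hf : Continuous f) {a : E × ℝ → X}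
    (ha : ContinuousOn a (unitSphere (E × ℝ))) {x : X} (hx : Joined (a (southPole E)) x)
    (hi : LoopInjective E f x) (hs : LoopSurjective (E × ℝ) f x) :
    Compressible (E × ℝ) f a := by
  have hcomp : ∀ {a : E × ℝ → X}, ContinuousOn a (unitSphere (E × ℝ)) →
      ContinuousOn (fun w => a (collapse w)) (unitSphere (E × ℝ) ×ˢ Icc (0 : ℝ) 1) :=
    fun ha => ha.comp continuousOn_collapse fun w hw => collapse_mem hw
  have hcomp1 : ∀ {a : E × ℝ → X}, ContinuousOn a (unitSphere (E × ℝ)) →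
      ContinuousOn (fun z => a (collapse (z, 1))) (unitSphere (E × ℝ)) :=
    fun ha => (hcomp ha).comp (f := fun z => (z, (1 : ℝ))) (by fun_prop)
      fun z hz => ⟨hz, by simp⟩
  intro b hb hab
  let γ := hx.somePath.extend
  have hγ : Continuous γ := hx.somePath.continuous_extend
  have hγ0 : γ 0 = a (southPole E) := hx.somePath.extend_zero
  have hγ1 : γ 1 = x := hx.somePath.extend_one
  -- the homotopy which moves the base point along the path
  let A : (E × ℝ) × ℝ → X := fun w => if w.1.2 ≤ 0 then γ (w.2 * (1 - ‖w.1.1‖))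
    else a (collapse (w.1, 1))
  have hA : ContinuousOn A (unitSphere (E × ℝ) ×ˢ Icc (0 : ℝ) 1) := by
    refine continuousOn_glue (by fun_prop) (by fun_prop) (by fun_prop) ?_ ?_
    · exact (hcomp1 ha).comp (by fun_prop) fun w hw => hw.1.1
    · intro w hw h0
      rw [collapse_one hw.1 (Or.inr h0.le), ← hγ0]
      rcases (mem_sphere_prod hw.1).2.2 with h | h | h
      · have : ‖w.1.1‖ = 1 := mem_sphere_zero_iff_norm.1 h
        rw [this]
        simp
      · linarith
      · linarith
  have hA0 : ∀ z ∈ unitSphere (E × ℝ), A (z, 0) = a (collapse (z, 1)) := by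
    intro z hz
    simp only [A, zero_mul]
    split_ifs with h
    · rw [collapse_one hz (Or.inr h), hγ0]
    · rfl
  let a₂ : E × ℝ → X := fun z => A (z, 1)
  have ha₂ : ContinuousOn a₂ (unitSphere (E × ℝ)) :=
    hA.comp (f := fun z => (z, (1 : ℝ))) (by fun_prop) fun z hz => ⟨hz, by simp⟩
  have ha₂x : a₂ (southPole E) = x := by
    simp [a₂, A, hγ1]
  -- `f ∘ a₂` extends to the ball
  obtain ⟨B, hB, -, hBa⟩ := exists_homotopy_extension hb (hf.comp_continuousOn (hcomp ha))
    fun z hz => by simp [collapse_zero hz, hab z hz]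
  obtain ⟨B', hB', -, hBa'⟩ := exists_homotopy_extension (b := fun z => B (z, 1))
    (hB.comp (by fun_prop) fun x hx => ⟨hx, by simp⟩) (hf.comp_continuousOn hA)
    fun z hz => by
      rw [hBa z hz 1 (by simp)]
      simp [hA0 z hz]
  let b₂ : E × ℝ → Y := fun z => B' (z, 1)
  have hb₂ : ContinuousOn b₂ (unitBall (E × ℝ)) :=
    hB'.comp (by fun_prop) fun x hx => ⟨hx, by simp⟩
  have hab₂ : ∀ z ∈ unitSphere (E × ℝ), b₂ z = f (a₂ z) := fun z hz => hBa' z hz 1 (by simp)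
  let a₃ : E × ℝ → X := fun z => a₂ (collapse (z, 1))
  have ha₃ : ContinuousOn a₃ (unitSphere (E × ℝ)) := hcomp1 ha₂
  have ha₃x : ∀ z ∈ unitSphere (E × ℝ), z.1 ∈ unitSphere E ∨ z.2 ≤ 0 → a₃ z = x := by
    intro z hz h
    simp only [a₃]
    rw [collapse_one hz h, ha₂x]
  have htop : ∀ {z : E}, z ∈ unitBall E → (z, (1 : ℝ)) ∈ unitSphere (E × ℝ) :=
    fun hz => mk_mem_sphere_right hz (by simp)
  have hpole : southPole E ∈ unitSphere (E × ℝ) := mk_mem_sphere_right (by simp) (by simp)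
  obtain ⟨K, hK, hK0, hK1, hKS⟩ := hi (fun z => a₃ (z, 1))
    (ha₃.comp (by fun_prop) fun z hz => htop hz)
    (fun z hz => ha₃x _ (htop (sphere_subset_ball hz)) (Or.inl hz))
    ⟨fun w => b₂ ((1 - w.2) • collapse ((w.1, 1), 1) + w.2 • southPole E), by
      refine hb₂.comp ?_ ?_
      · have : ContinuousOn (fun w : E × ℝ => collapse ((w.1, (1 : ℝ)), (1 : ℝ))) (cylinder E) :=
          continuousOn_collapse.comp (by fun_prop) fun w hw => ⟨htop hw.1, by simp⟩
        fun_prop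
      · intro w hw
        exact (convex_closedBall (0 : E × ℝ) 1) (sphere_subset_ball (collapse_mem
          ⟨htop hw.1, by simp⟩)) (sphere_subset_ball hpole) (by linarith [hw.2.2]) hw.2.1
          (by ring), by
      intro z hz
      have h1 : collapse ((z, (1 : ℝ)), (1 : ℝ)) ∈ unitSphere (E × ℝ) :=
        collapse_mem ⟨htop hz, by simp⟩
      simp only [sub_zero, one_smul, zero_smul, add_zero]
      rw [hab₂ _ h1]
      rfl, by
      intro z hz
      simp only [sub_self, zero_smul, one_smul, zero_add]
      rw [hab₂ _ hpole, ha₂x], by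
      intro z hz t ht
      have h1 := htop (sphere_subset_ball hz)
      simp only [Function.comp_apply]
      rw [ha₃x _ h1 (Or.inl hz), collapse_one h1 (Or.inl hz), ← add_smul, sub_add_cancel,
        one_smul, hab₂ _ hpole, ha₂x]⟩
  have hK' : ContinuousOn (fun w : (E × ℝ) × ℝ => if w.1.2 ≤ 0 then x else K (w.1.1, w.2))
      (unitSphere (E × ℝ) ×ˢ Icc (0 : ℝ) 1) := by
    refine continuousOn_glue (by fun_prop) (by fun_prop) (by fun_prop) ?_ ?_
    · exact hK.comp (by fun_prop) fun w hw => ⟨(mem_sphere_prod hw.1.1).1, hw.1.2⟩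
    · intro w hw h0
      rcases (mem_sphere_prod hw.1).2.2 with h | h | h
      · rw [hKS _ h _ hw.2]
        simp only
        rw [ha₃x _ (htop (sphere_subset_ball h)) (Or.inl h)]
      · linarith
      · linarith
  have c4 : Compressible (E × ℝ) f fun _ => x := fun b hb hab =>
    hs b hb fun z hz => (hab z hz).symm
  have c3 : Compressible (E × ℝ) f a₃ := by
    refine (Compressible.of_homotopy hf hK' (c4.congr fun z hz => ?_)).congr fun z hz => ?_
    · simp only
      split_ifs with h
      · rfl
      · rw [hK1 _ (mem_sphere_prod hz).1]
    · simp only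
      split_ifs with h
      · exact (ha₃x z hz (Or.inr h)).symm
      · rw [hK0 _ (mem_sphere_prod hz).1]
        rcases (mem_sphere_prod hz).2.2 with h' | h' | h'
        · simp only
          rw [ha₃x _ (htop (sphere_subset_ball h')) (Or.inl h'), ha₃x _ hz (Or.inl h')]
        · rw [h'] at h
          norm_num at h
        · rw [← h']
  have c2 : Compressible (E × ℝ) f a₂ :=
    (Compressible.of_homotopy hf (hcomp ha₂) c3).congr fun z hz => by rw [collapse_zero hz]
  have c1 : Compressible (E × ℝ) f a :=
    (Compressible.of_homotopy hf (hcomp ha) ((Compressible.of_homotopy hf hA c2).congr hA0)).congr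
      fun z hz => by rw [collapse_zero hz]
  exact c1 b hb hab

end BallHomotopy

namespace NumericallyGenerated

open Metric Set BallHomotopy

/-! ### Cubes and balls -/

section Cube

variable {n : ℕ} {X : Type*} [TopologicalSpace X]

/-- The affine map from the unit cube to the unit ball for the supremum norm. -/
def ofCube (y : Fin n → unitInterval) : Fin n → ℝ := fun i => 2 * (y i : ℝ) - 1

/-- The map from the unit ball for the supremum norm to the unit cube. -/
noncomputable def toCube (x : Fin n → ℝ) : Fin n → unitInterval :=
  fun i => projIcc 0 1 zero_le_one ((x i + 1) / 2)

lemma continuous_ofCube : Continuous (ofCube : (Fin n → unitInterval) → _) := by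
  unfold ofCube
  fun_prop

lemma continuous_toCube : Continuous (toCube : (Fin n → ℝ) → _) :=
  continuous_pi fun i => continuous_projIcc.comp (by fun_prop)

lemma ofCube_mem (y : Fin n → unitInterval) : ofCube y ∈ unitBall (Fin n → ℝ) := by
  rw [mem_closedBall_zero_iff, pi_norm_le_iff_of_nonneg zero_le_one]
  intro i
  rw [Real.norm_eq_abs, abs_le, ofCube]
  have h1 := (y i).2.1
  have h2 := (y i).2.2
  constructor <;> linarith

lemma toCube_ofCube (y : Fin n → unitInterval) : toCube (ofCube y) = y := by
  ext i
  simp [toCube, ofCube]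

lemma ofCube_toCube {x : Fin n → ℝ} (hx : x ∈ unitBall (Fin n → ℝ)) : ofCube (toCube x) = x := by
  ext i
  rw [mem_closedBall_zero_iff, pi_norm_le_iff_of_nonneg zero_le_one] at hx
  obtain ⟨h1, h2⟩ := abs_le.1 (hx i)
  simp only [ofCube, toCube]
  rw [projIcc_of_mem _ (by constructor <;> linarith)]
  simp only
  ring

lemma ofCube_mem_sphere {y : Fin n → unitInterval} :
    ofCube y ∈ unitSphere (Fin n → ℝ) ↔ y ∈ Cube.boundary (Fin n) := by
  have key : ∀ i, ‖ofCube y i‖ = 1 ↔ y i = 0 ∨ y i = 1 := by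
    intro i
    rw [Real.norm_eq_abs, ofCube, abs_eq zero_le_one, or_comm, Subtype.ext_iff, Subtype.ext_iff]
    refine or_congr ⟨fun h => ?_, fun h => ?_⟩ ⟨fun h => ?_, fun h => ?_⟩
    · rw [Icc.coe_zero]
      linarith
    · rw [h, Icc.coe_zero]
      norm_num
    · rw [Icc.coe_one]
      linarith
    · rw [h, Icc.coe_one]
      norm_num
  have hle := mem_closedBall_zero_iff.1 (ofCube_mem y)
  rw [mem_sphere_zero_iff_norm]
  constructor
  · intro h
    by_contra h'
    simp only [Cube.boundary, mem_ofPred_eq, not_exists, ← key] at h'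
    refine absurd h (ne_of_lt ((pi_norm_lt_iff zero_lt_one).2 fun i => lt_of_le_of_ne ?_ (h' i)))
    exact (norm_le_pi_norm _ i).trans hle
  · rintro ⟨i, hi⟩
    refine le_antisymm hle ?_
    rw [← (key i).2 hi]
    exact norm_le_pi_norm _ i

lemma toCube_mem_boundary {x : Fin n → ℝ} (hx : x ∈ unitSphere (Fin n → ℝ)) :
    toCube x ∈ Cube.boundary (Fin n) := by
  rw [← ofCube_mem_sphere, ofCube_toCube (sphere_subset_ball hx)]
  exact hx

lemma homotopicRel_iff (f g : C(Fin n → unitInterval, X)) :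
    f.HomotopicRel g (Cube.boundary (Fin n)) ↔
      RelHomotopic (Fin n → ℝ) (f ∘ toCube) (g ∘ toCube) := by
  constructor
  · rintro ⟨H⟩
    refine ⟨fun z => H (projIcc 0 1 zero_le_one z.2, toCube z.1), ?_, ?_, ?_, ?_⟩
    · exact (H.continuous.comp ((continuous_projIcc.comp (by fun_prop)).prodMk
        (continuous_toCube.comp (by fun_prop)))).continuousOn
    · intro x _
      simp
    · intro x _
      simp
    · intro x hx t _
      exact H.eq_fst _ (toCube_mem_boundary hx)
  · rintro ⟨H, hH, hH0, hH1, hHS⟩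
    exact ⟨{
      toFun := fun z => H (ofCube z.2, z.1)
      continuous_toFun := hH.comp_continuous
        ((continuous_ofCube.comp continuous_snd).prodMk (by fun_prop))
        fun z => ⟨ofCube_mem _, z.1.2⟩
      map_zero_left := fun y => by simp [hH0 _ (ofCube_mem _), toCube_ofCube]
      map_one_left := fun y => by simp [hH1 _ (ofCube_mem _), toCube_ofCube]
      prop' := fun t y hy => by
        simp [hHS _ (ofCube_mem_sphere.2 hy) _ t.2, toCube_ofCube] }⟩

/-- The loop attached to a map on the unit ball which is constant on the unit sphere. -/
def loopOfBall (a : (Fin n → ℝ) → X) (ha : ContinuousOn a (unitBall _)) {x : X}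
    (hx : ∀ z ∈ unitSphere _, a z = x) : GenLoop (Fin n) X x :=
  ⟨⟨fun y => a (ofCube y), ha.comp_continuous continuous_ofCube ofCube_mem⟩,
    fun _ hy => hx _ (ofCube_mem_sphere.2 hy)⟩

end Cube

lemma _root_.BallHomotopy.RelHomotopic.congr {E : Type*} [NormedAddCommGroup E] {X : Type*}
    [TopologicalSpace X] {f f' g g' : E → X} (h : RelHomotopic E f g)
    (hf : ∀ x ∈ unitBall E, f x = f' x) (hg : ∀ x ∈ unitBall E, g x = g' x) :
    RelHomotopic E f' g' := by
  obtain ⟨H, h1, h2, h3, h4⟩ := h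
  exact ⟨H, h1, fun x hx => (h2 x hx).trans (hf x hx), fun x hx => (h3 x hx).trans (hg x hx),
    fun x hx t ht => (h4 x hx t ht).trans (hf x (sphere_subset_ball hx))⟩

variable {X Y Z : Type u} [TopologicalSpace X] [TopologicalSpace Y] [TopologicalSpace Z]

/-! ### Functoriality of homotopy groups -/

lemma mapHomotopyGroup_comp (g : C(Y, Z)) (f : C(X, Y)) (n : ℕ) (x : X) :
    mapHomotopyGroup (g.comp f) n x = mapHomotopyGroup g n (f x) ∘ mapHomotopyGroup f n x := by
  ext ⟨a⟩
  rfl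

lemma mapZerothHomotopy_comp (g : C(Y, Z)) (f : C(X, Y)) :
    mapZerothHomotopy (g.comp f) = mapZerothHomotopy g ∘ mapZerothHomotopy f := by
  ext ⟨a⟩
  rfl

lemma exists_joined_of_surjective {f : C(X, Y)}
    (hf : Function.Surjective (mapZerothHomotopy f)) (y : Y) : ∃ x, Joined (f x) y := by
  obtain ⟨⟨x⟩, hx⟩ := hf (Quotient.mk _ y)
  exact ⟨x, Quotient.exact hx⟩

lemma joined_of_injective {f : C(X, Y)}
    (hf : Function.Injective (mapZerothHomotopy f)) {x x' : X} (h : Joined (f x) (f x')) :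
    Joined x x' := by
  have : (Quotient.mk _ x : ZerothHomotopy X) = Quotient.mk _ x' := hf (Quotient.sound h)
  exact Quotient.exact this

lemma loopInjective_of_injective {f : C(X, Y)} {n : ℕ} {x : X}
    (hf : Function.Injective (mapHomotopyGroup f n x)) : LoopInjective (Fin n → ℝ) f x := by
  intro a ha hax h
  have h1 : mapHomotopyGroup f n x (Quotient.mk _ (loopOfBall a ha hax)) =
      mapHomotopyGroup f n x (Quotient.mk _ GenLoop.const) := by
    refine Quotient.sound ((homotopicRel_iff _ _).2 (h.congr (fun z hz => ?_) fun z hz => rfl))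
    simp [loopOfBall, ofCube_toCube hz]
  refine ((homotopicRel_iff _ _).1 (Quotient.exact (hf h1))).congr (fun z hz => ?_) fun z hz => rfl
  simp [loopOfBall, ofCube_toCube hz]

lemma loopSurjective_of_surjective {f : C(X, Y)} {n : ℕ} {x : X}
    (hf : Function.Surjective (mapHomotopyGroup f n x)) : LoopSurjective (Fin n → ℝ) f x := by
  intro b hb hbx
  obtain ⟨⟨a⟩, ha⟩ := hf (Quotient.mk _ (loopOfBall b hb hbx))
  refine ⟨a.1 ∘ toCube, (a.1.continuous.comp continuous_toCube).continuousOn,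
    fun z hz => a.2 _ (toCube_mem_boundary hz),
    ((homotopicRel_iff _ _).1 (Quotient.exact ha)).congr (fun z hz => rfl) fun z hz => ?_⟩
  simp [loopOfBall, ofCube_toCube hz]

lemma unitSphere_eq_empty_of_subsingleton (E : Type*) [NormedAddCommGroup E] [Subsingleton E]
    {x : E} (hx : x ∈ unitSphere E) : False := by
  have : ‖x‖ = 1 := mem_sphere_zero_iff_norm.1 hx
  rw [Subsingleton.elim x 0] at this
  simp at this

lemma relHomotopic_of_joined {E : Type*} [NormedAddCommGroup E] [Subsingleton E] {X : Type*}
    [TopologicalSpace X] {f g : E → X} (h : Joined (f 0) (g 0)) : RelHomotopic E f g := by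
  refine ⟨fun z => h.somePath.extend z.2, by fun_prop, fun x _ => ?_, fun x _ => ?_,
    fun x hx => (unitSphere_eq_empty_of_subsingleton E hx).elim⟩
  · rw [Subsingleton.elim x 0]
    exact h.somePath.extend_zero
  · rw [Subsingleton.elim x 0]
    exact h.somePath.extend_one

lemma joined_of_relHomotopic {E : Type*} [NormedAddCommGroup E] {X : Type*}
    [TopologicalSpace X] {f g : E → X} (h : RelHomotopic E f g) : Joined (f 0) (g 0) := by
  obtain ⟨H, h1, h2, h3, -⟩ := h
  have h0 : (0 : E) ∈ unitBall E := by simp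
  exact ⟨{
    toFun := fun t => H (0, t)
    continuous_toFun := h1.comp_continuous (by fun_prop) fun t => ⟨h0, t.2⟩
    source' := h2 _ h0
    target' := h3 _ h0 }⟩

/-- A variant of the definition of weak homotopy equivalences where only one base point in each
path component is considered. -/
lemma compression_of_basepoints {f : C(X, Y)} (h0 : Function.Bijective (mapZerothHomotopy f))
    (h : ∀ x : X, ∃ x', Joined x x' ∧
      ∀ n : ℕ, 0 < n → Function.Bijective (mapHomotopyGroup f n x'))
    (E : Type*) [NormedAddCommGroup E] [NormedSpace ℝ E] [FiniteDimensional ℝ E] :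
    Compression E f := by
  obtain hn | ⟨n, hn⟩ : Module.finrank ℝ E = 0 ∨ ∃ n, Module.finrank ℝ E = n + 1 := by
    cases h : Module.finrank ℝ E with
    | zero => exact Or.inl rfl
    | succ n => exact Or.inr ⟨n, rfl⟩
  · have := Module.finrank_zero_iff.1 hn
    intro a ha b hb hab
    obtain ⟨x, hx⟩ := exists_joined_of_surjective h0.2 (b 0)
    exact ⟨fun _ => x, by fun_prop,
      fun x hx => (unitSphere_eq_empty_of_subsingleton E hx).elim, relHomotopic_of_joined hx⟩
  · obtain ⟨φ, hφ⟩ := exists_norm_preserving_homeomorph (E := (Fin n → ℝ) × ℝ) (F := E)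
      (by simp [hn])
    refine Compression.of_homeomorph φ hφ fun a ha => ?_
    obtain ⟨x, hx, hx'⟩ := h (a (southPole (Fin n → ℝ)))
    refine compressible_of_loop f.continuous ha hx ?_ ?_
    · cases n with
      | zero =>
        intro a ha hax h
        exact relHomotopic_of_joined (joined_of_injective h0.1 (joined_of_relHomotopic h))
      | succ n => exact loopInjective_of_injective (hx' _ n.succ_pos).1
    · obtain ⟨ψ, hψ⟩ := exists_norm_preserving_homeomorph (E := Fin (n + 1) → ℝ)
        (F := (Fin n → ℝ) × ℝ) (by simp)
      exact LoopSurjective.of_homeomorph ψ hψ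
        (loopSurjective_of_surjective (hx' _ n.succ_pos).2)

lemma IsWeakHomotopyEquivalence.compression {f : C(X, Y)} (hf : IsWeakHomotopyEquivalence f)
    (E : Type*) [NormedAddCommGroup E] [NormedSpace ℝ E] [FiniteDimensional ℝ E] :
    Compression E f :=
  compression_of_basepoints hf.1 (fun x => ⟨x, Joined.refl x, fun n hn => hf.2 n hn x⟩) E

lemma isWeakHomotopyEquivalence_of_compression {f : C(X, Y)} (h0 : ∀ y, ∃ x, Joined (f x) y)
    (h : ∀ n : ℕ, Compression (EuclideanSpace ℝ (Fin n)) f) : IsWeakHomotopyEquivalence f := by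
  have hc : ∀ (E : Type) [NormedAddCommGroup E] [NormedSpace ℝ E] [FiniteDimensional ℝ E],
      Compression E f := by
    intro E _ _ _
    obtain ⟨φ, hφ⟩ := exists_norm_preserving_homeomorph
      (E := EuclideanSpace ℝ (Fin (Module.finrank ℝ E))) (F := E) (by simp)
    exact (h _).of_homeomorph φ hφ
  refine ⟨⟨?_, ?_⟩, fun n _ x => ⟨?_, ?_⟩⟩
  · rintro ⟨x⟩ ⟨x'⟩ hxx'
    have h1 : Joined (f x) (f x') := Quotient.exact hxx'
    refine Quotient.sound (joined_of_relHomotopic ((hc ((Fin 0 → ℝ) × ℝ)).relHomotopic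
      (f := fun _ => x) (g := fun _ => x') (by fun_prop) (by fun_prop)
      (fun z hz => (unitSphere_eq_empty_of_subsingleton _ hz).elim) (relHomotopic_of_joined h1)))
  · rintro ⟨y⟩
    obtain ⟨x, hx⟩ := h0 y
    exact ⟨Quotient.mk _ x, Quotient.sound hx⟩
  · rintro ⟨a⟩ ⟨a'⟩ haa'
    refine Quotient.sound ((homotopicRel_iff _ _).2 ((hc ((Fin n → ℝ) × ℝ)).relHomotopic ?_ ?_ ?_
      ((homotopicRel_iff _ _).1 (Quotient.exact haa'))))
    · exact (a.1.continuous.comp continuous_toCube).continuousOn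
    · exact (a'.1.continuous.comp continuous_toCube).continuousOn
    · intro z hz
      exact (a.2 _ (toCube_mem_boundary hz)).trans (a'.2 _ (toCube_mem_boundary hz)).symm
  · rintro ⟨b⟩
    obtain ⟨k, hk, hkx, hkb⟩ := hc (Fin n → ℝ) (fun _ => x) (by fun_prop) (b.1 ∘ toCube)
      (b.1.continuous.comp continuous_toCube).continuousOn
      (fun z hz => (b.2 _ (toCube_mem_boundary hz)).symm)
    refine ⟨Quotient.mk _ (loopOfBall k hk hkx), Quotient.sound ((homotopicRel_iff _ _).2
      (hkb.congr (fun z hz => ?_) fun z hz => rfl))⟩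
    simp [loopOfBall, ofCube_toCube hz]

/-! ### The two out of three property -/

lemma IsWeakHomotopyEquivalence.comp {g : C(Y, Z)} {f : C(X, Y)}
    (hg : IsWeakHomotopyEquivalence g) (hf : IsWeakHomotopyEquivalence f) :
    IsWeakHomotopyEquivalence (g.comp f) := by
  refine ⟨?_, fun n hn x => ?_⟩
  · rw [mapZerothHomotopy_comp]
    exact hg.1.comp hf.1
  · rw [mapHomotopyGroup_comp]
    exact (hg.2 n hn _).comp (hf.2 n hn x)

lemma IsWeakHomotopyEquivalence.of_comp_left {g : C(Y, Z)} {f : C(X, Y)}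
    (hg : IsWeakHomotopyEquivalence g) (h : IsWeakHomotopyEquivalence (g.comp f)) :
    IsWeakHomotopyEquivalence f := by
  refine ⟨?_, fun n hn x => ?_⟩
  · have h1 := h.1
    rw [mapZerothHomotopy_comp] at h1
    exact (Function.Bijective.of_comp_iff' hg.1 _).1 h1
  · have h1 := h.2 n hn x
    rw [mapHomotopyGroup_comp] at h1
    exact (Function.Bijective.of_comp_iff' (hg.2 n hn _) _).1 h1

lemma IsWeakHomotopyEquivalence.of_comp_right {g : C(Y, Z)} {f : C(X, Y)}
    (hf : IsWeakHomotopyEquivalence f) (h : IsWeakHomotopyEquivalence (g.comp f)) :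
    IsWeakHomotopyEquivalence g := by
  have h0 : Function.Bijective (mapZerothHomotopy g) := by
    have h1 := h.1
    rw [mapZerothHomotopy_comp] at h1
    exact (Function.Bijective.of_comp_iff _ hf.1).1 h1
  refine isWeakHomotopyEquivalence_of_compression (exists_joined_of_surjective h0.2) fun n =>
    compression_of_basepoints h0 (fun y => ?_) _
  obtain ⟨x, hx⟩ := exists_joined_of_surjective hf.1.2 y
  refine ⟨f x, hx.symm, fun n hn => ?_⟩
  have h1 := h.2 n hn x
  rw [mapHomotopyGroup_comp] at h1
  exact (Function.Bijective.of_comp_iff _ (hf.2 n hn x)).1 h1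

/-! ### Fibrations and weak homotopy equivalences -/

lemma homotopyLifting_of_euclidean {p : X → Y}
    (h : ∀ n : ℕ, HomotopyLifting (EuclideanSpace ℝ (Fin n)) p)
    (E : Type*) [NormedAddCommGroup E] [NormedSpace ℝ E] [FiniteDimensional ℝ E] :
    HomotopyLifting E p := by
  obtain ⟨φ, hφ⟩ := exists_norm_preserving_homeomorph
    (E := EuclideanSpace ℝ (Fin (Module.finrank ℝ E))) (F := E) (by simp)
  exact (h _).of_homeomorph φ hφ

lemma sphereLifting_of_euclidean {p : X → Y}
    (h : ∀ n : ℕ, SphereLifting (EuclideanSpace ℝ (Fin n)) p)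
    (E : Type*) [NormedAddCommGroup E] [NormedSpace ℝ E] [FiniteDimensional ℝ E] :
    SphereLifting E p := by
  obtain ⟨φ, hφ⟩ := exists_norm_preserving_homeomorph
    (E := EuclideanSpace ℝ (Fin (Module.finrank ℝ E))) (F := E) (by simp)
  exact (h _).of_homeomorph φ hφ

/-- A map has the right lifting property with respect to all inclusions of spheres in disks if and
only if it is a Serre fibration and a weak homotopy equivalence. -/
theorem sphereLifting_iff (p : C(X, Y)) :
    (Function.Surjective p ∧ ∀ n : ℕ, SphereLifting (EuclideanSpace ℝ (Fin n)) p) ↔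
      (∀ n : ℕ, HomotopyLifting (EuclideanSpace ℝ (Fin n)) p) ∧ IsWeakHomotopyEquivalence p := by
  constructor
  · rintro ⟨h1, h2⟩
    refine ⟨fun n => (h2 n).homotopyLifting (sphereLifting_of_euclidean h2 _),
      isWeakHomotopyEquivalence_of_compression (fun y => ?_)
        fun n => (h2 n).compression p.continuous⟩
    obtain ⟨x, rfl⟩ := h1 y
    exact ⟨x, Joined.refl _⟩
  · rintro ⟨h1, h2⟩
    refine ⟨fun y => ?_, fun n => (h2.compression _).sphereLifting
      (homotopyLifting_of_euclidean h1 _)⟩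
    obtain ⟨x, hx⟩ := exists_joined_of_surjective h2.1.2 y
    obtain ⟨K, -, -, hK⟩ := h1 0 (fun _ => x) (fun z => hx.somePath.extend z.2) (by fun_prop)
      (by fun_prop) fun z _ => hx.somePath.extend_zero
    exact ⟨K (0, 1), (hK (0, 1) ⟨by simp, by simp⟩).trans hx.somePath.extend_one⟩

/-- The inclusion of a strong deformation retract is a weak homotopy equivalence. -/
lemma isWeakHomotopyEquivalence_of_deformation {j : C(X, Y)} {r : C(Y, X)}
    (hr : ∀ x, r (j x) = x) {H : C(Y, C(unitInterval, Y))} (hH0 : ∀ y, H y 0 = j (r y))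
    (hH1 : ∀ y, H y 1 = y) (hH : ∀ x t, H (j x) t = j x) : IsWeakHomotopyEquivalence j := by
  refine isWeakHomotopyEquivalence_of_compression (fun y => ⟨r y, ⟨{
    toFun := H y
    source' := hH0 y
    target' := hH1 y }⟩⟩) fun n a ha b hb hab => ?_
  refine ⟨r ∘ b, r.continuous.comp_continuousOn hb, fun x hx => ?_,
    fun z => H (b z.1) (projIcc 0 1 zero_le_one z.2), ?_, fun x hx => ?_, fun x hx => ?_,
    fun x hx t ht => ?_⟩
  · rw [Function.comp_apply, ← hab x hx, hr]
  · have h1 : Continuous fun z : Y × unitInterval => H z.1 z.2 := by fun_prop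
    exact h1.comp_continuousOn (g := fun z : Y × unitInterval => H z.1 z.2)
      (f := fun z : EuclideanSpace ℝ (Fin n) × ℝ => (b z.1, projIcc 0 1 zero_le_one z.2))
      ((hb.comp (by fun_prop) fun z hz => hz.1).prodMk
        (continuous_projIcc.comp continuous_snd).continuousOn)
  · simp [hH0]
  · simp [hH1]
  · simp only [← hab x hx, Function.comp_apply]
    rw [hH, hr]

end NumericallyGenerated

/-! ### Closed `T₁` inclusions of topological spaces -/

namespace TopCat

open Topology Set

/-- The closed embeddings such that the points in the complement of the image are closed. -/
def closedT1Inclusions : MorphismProperty TopCat.{u} :=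
  fun _ Y f => IsClosedEmbedding f ∧ ∀ y : Y, y ∉ range f → IsClosed {y}

lemma closedT1Inclusions_of_isIso {X Y : TopCat.{u}} (f : X ⟶ Y) [IsIso f] :
    closedT1Inclusions f :=
  ⟨(homeoOfIso (asIso f)).isClosedEmbedding,
    fun y hy => (hy ((homeoOfIso (asIso f)).surjective y)).elim⟩

instance : closedT1Inclusions.{u}.IsMultiplicative where
  id_mem _ := closedT1Inclusions_of_isIso _
  comp_mem f g hf hg := by
    refine ⟨hg.1.comp hf.1, fun y hy => ?_⟩
    by_cases h : y ∈ range g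
    · obtain ⟨z, rfl⟩ := h
      have hz : z ∉ range f := by
        rintro ⟨x, rfl⟩
        exact hy ⟨x, rfl⟩
      have := hg.1.isClosedMap _ (hf.2 z hz)
      rwa [image_singleton] at this
    · exact hg.2 y h

instance : closedT1Inclusions.{u}.RespectsIso :=
  MorphismProperty.respectsIso_of_isStableUnderComposition
    fun _ _ f (_ : IsIso f) => closedT1Inclusions_of_isIso f

lemma isClosed_iff_of_isPushout {A B X Y : TopCat.{u}} {i : A ⟶ B} {g : A ⟶ X} {k : B ⟶ Y}
    {j : X ⟶ Y} (h : IsPushout i g k j) (C : Set Y) :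
    IsClosed C ↔ IsClosed (k ⁻¹' C) ∧ IsClosed (j ⁻¹' C) := by
  refine ⟨fun hC => ⟨hC.preimage k.hom.continuous, hC.preimage j.hom.continuous⟩, fun hC => ?_⟩
  refine (isClosed_iff_of_isColimit _ h.isColimit C).2 fun o => ?_
  rcases o with _ | _ | _
  · have : IsClosed (i ⁻¹' (k ⁻¹' C)) := hC.1.preimage i.hom.continuous
    simpa using! this
  · exact hC.1
  · exact hC.2

instance : closedT1Inclusions.{u}.IsStableUnderCobaseChange where
  of_isPushout {A B X Y i g j k} sq hi := by
    replace sq := sq.flip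
    have sq' : IsPushout ((forget TopCat).map i) ((forget TopCat).map g)
      ((forget TopCat).map k) ((forget TopCat).map j) := sq.map (forget TopCat)
    have hinj : Function.Injective i := hi.1.injective
    have hj : Function.Injective j := by
      exact Types.pushoutCocone_inr_injective_of_isColimit sq'.isColimit hinj
    have key : ∀ (b : B) (x : X), k b = j x → ∃ a, i a = b ∧ g a = x := by
      intro b x hbx
      obtain ⟨a, h1, h2⟩ := (Types.pushoutCocone_inl_eq_inr_iff_of_isColimit sq'.isColimit hinj
        b x).1 hbx
      exact ⟨a, h1, h2⟩
    have hcover := Types.eq_or_eq_of_isPushout' sq'.flip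
    have hw : ∀ a, k (i a) = j (g a) := fun a => ConcreteCategory.congr_hom sq.w a
    refine ⟨.of_continuous_injective_isClosedMap j.hom.continuous hj fun C hC => ?_,
      fun y hy => ?_⟩
    · rw [isClosed_iff_of_isPushout sq]
      refine ⟨?_, ?_⟩
      · have : k ⁻¹' (j '' C) = i '' (g ⁻¹' C) := by
          ext b
          constructor
          · rintro ⟨x, hx, hxb⟩
            obtain ⟨a, rfl, rfl⟩ := key b x hxb.symm
            exact ⟨a, hx, rfl⟩
          · rintro ⟨a, ha, rfl⟩
            exact ⟨g a, ha, (hw a).symm⟩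
        rw [this]
        exact hi.1.isClosedMap _ (hC.preimage g.hom.continuous)
      · rwa [preimage_image_eq _ hj]
    · obtain ⟨x, rfl⟩ | ⟨b, rfl, hb⟩ := hcover y
      · exact (hy ⟨x, rfl⟩).elim
      · replace hb : b ∉ range i := hb
        rw [isClosed_iff_of_isPushout sq]
        refine ⟨?_, ?_⟩
        · have : k ⁻¹' {(forget TopCat).map k b} = {b} := by
            ext b'
            refine ⟨fun hb' => ?_, fun hb' => by rw [mem_singleton_iff.1 hb']; rfl⟩
            have h2 : k b' = k b := hb'
            let φ : (forget TopCat).obj B ⟶ ULift.{u} Prop := ↾fun z => ULift.up (z = b)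
            let ψ : (forget TopCat).obj X ⟶ ULift.{u} Prop := ↾fun _ => ULift.up False
            have hφ : (forget TopCat).map i ≫ φ = (forget TopCat).map g ≫ ψ := by
              ext a
              have : ¬ i a = b := fun h => hb ⟨a, h⟩
              exact iff_false_intro this
            have h3 : ∀ z, sq'.desc φ ψ hφ (k z) = ULift.up (z = b) :=
              fun z => ConcreteCategory.congr_hom (sq'.inl_desc φ ψ hφ) z
            have h4 : ULift.up.{u} (b' = b) = ULift.up (b = b) := by rw [← h3, ← h3, h2]
            have h5 : (b' = b) = (b = b) := congrArg ULift.down h4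
            exact h5.mpr rfl
          rw [this]
          exact hi.2 b hb
        · convert isClosed_empty
          ext x
          simp only [mem_preimage, mem_singleton_iff, mem_empty_iff_false, iff_false]
          rintro hx
          exact hy ⟨x, hx⟩

instance (J : Type u) : closedT1Inclusions.{u}.IsStableUnderCoproductsOfShape J := by
  refine MorphismProperty.IsStableUnderCoproductsOfShape.mk _ _ fun X₁ X₂ _ _ f hf => ?_
  let F : TopCat.of (Σ j, X₁ j) ⟶ TopCat.of (Σ j, X₂ j) :=
    ofHom ⟨Sigma.map id fun j => f j, Continuous.sigma_map fun j => (f j).hom.continuous⟩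
  have e : Arrow.mk (Limits.Sigma.map f) ≅ Arrow.mk F :=
    Arrow.isoMk (sigmaIsoSigma.{u, u} X₁) (sigmaIsoSigma.{u, u} X₂) (by
      apply Limits.Sigma.hom_ext
      intro j
      ext x
      have h1 : Limits.Sigma.map f (Sigma.ι X₁ j x) = Sigma.ι X₂ j (f j x) :=
        ConcreteCategory.congr_hom (Limits.Sigma.ι_map f j) x
      change F ((sigmaIsoSigma X₁).hom (Sigma.ι X₁ j x)) =
        (sigmaIsoSigma X₂).hom (Limits.Sigma.map f (Sigma.ι X₁ j x))
      rw [h1, sigmaIsoSigma_hom_ι_apply, sigmaIsoSigma_hom_ι_apply]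
      rfl)
  rw [closedT1Inclusions.arrow_mk_iso_iff e]
  have hemb : IsEmbedding (Sigma.map id fun j => ⇑(f j) :
      (Σ j, X₁ j) → Σ j, X₂ j) :=
    (isEmbedding_sigmaMap Function.injective_id).2 fun j => (hf j).1.isEmbedding
  refine ⟨⟨hemb, ?_⟩, ?_⟩
  · rw [isClosed_sigma_iff]
    intro j
    convert (hf j).1.isClosed_range
    ext x
    constructor
    · rintro ⟨⟨j', y⟩, hy⟩
      obtain ⟨rfl, hy⟩ := Sigma.mk.inj_iff.1 (show (⟨j', f j' y⟩ : Σ j, X₂ j) = ⟨j, x⟩ from hy)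
      exact ⟨y, eq_of_heq hy⟩
    · rintro ⟨y, rfl⟩
      exact ⟨⟨j, y⟩, rfl⟩
  · rintro ⟨j, x⟩ hx
    have hx' : x ∉ range (f j) := by
      rintro ⟨y, rfl⟩
      exact hx ⟨⟨j, y⟩, rfl⟩
    have := isClosedMap_sigmaMk (σ := fun j => X₂ j) (i := j) _ ((hf j).2 x hx')
    rwa [image_singleton] at this

instance : MorphismProperty.IsStableUnderCoproducts.{u} closedT1Inclusions.{u} where

section Sequence

variable {J : Type u} [LinearOrder J] {F : J ⥤ TopCat.{u}}

lemma closedT1Inclusions_ι_app [Nonempty J]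
    (hF : ∀ ⦃i j : J⦄ (φ : i ⟶ j), closedT1Inclusions (F.map φ)) {c : Cocone F}
    (hc : IsColimit c) (i : J) : closedT1Inclusions (c.ι.app i) := by
  have hc' := isColimitOfPreserves (forget TopCat) hc
  have hw : ∀ {i j : J} (φ : i ⟶ j) (x : F.obj i), c.ι.app j (F.map φ x) = c.ι.app i x :=
    fun φ x => ConcreteCategory.congr_hom (c.w φ) x
  have hinj : ∀ i, Function.Injective (c.ι.app i) := by
    intro i x y hxy
    obtain ⟨j, φ, hj⟩ := (Types.FilteredColimit.isColimit_eq_iff' hc' x y).1 hxy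
    exact (hF φ).1.injective hj
  refine ⟨.of_continuous_injective_isClosedMap (c.ι.app i).hom.continuous (hinj i)
    fun C hC => ?_, fun y hy => ?_⟩
  · rw [isClosed_iff_of_isColimit c hc]
    intro j
    rcases le_total j i with h | h
    · have : c.ι.app j ⁻¹' (c.ι.app i '' C) = F.map (homOfLE h) ⁻¹' C := by
        ext x
        constructor
        · rintro ⟨z, hz, hzx⟩
          rw [← hw (homOfLE h)] at hzx
          rwa [mem_preimage, ← hinj _ hzx]
        · intro hx
          exact ⟨_, hx, hw _ _⟩
      rw [this]
      exact hC.preimage (F.map _).hom.continuous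
    · have : c.ι.app j ⁻¹' (c.ι.app i '' C) = F.map (homOfLE h) '' C := by
        ext x
        constructor
        · rintro ⟨z, hz, hzx⟩
          rw [← hw (homOfLE h)] at hzx
          exact ⟨z, hz, hinj _ hzx⟩
        · rintro ⟨z, hz, rfl⟩
          exact ⟨z, hz, (hw (homOfLE h) z).symm⟩
      rw [this]
      exact (hF _).1.isClosedMap _ hC
  · obtain ⟨k, hik, z, rfl⟩ : ∃ (k : J) (_ : i ≤ k) (z : F.obj k), c.ι.app k z = y := by
      obtain ⟨k, z, hz⟩ := Types.jointly_surjective_of_isColimit hc' y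
      refine ⟨max i k, le_max_left _ _, F.map (homOfLE (le_max_right _ _)) z, ?_⟩
      rw [hw]
      exact hz
    rw [isClosed_iff_of_isColimit c hc]
    intro j
    rcases le_total j k with h | h
    · have : c.ι.app j ⁻¹' {c.ι.app k z} = F.map (homOfLE h) ⁻¹' {z} := by
        ext x
        simp only [mem_preimage, mem_singleton_iff]
        rw [← hw (homOfLE h), (hinj k).eq_iff]
      rw [this]
      refine IsClosed.preimage (F.map _).hom.continuous ((hF (homOfLE hik)).2 z ?_)
      rintro ⟨x, rfl⟩
      exact hy ⟨x, (hw (homOfLE hik) x).symm⟩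
    · have : c.ι.app j ⁻¹' {c.ι.app k z} = {F.map (homOfLE h) z} := by
        ext x
        simp only [mem_preimage, mem_singleton_iff]
        rw [← hw (homOfLE h), (hinj j).eq_iff]
      rw [this]
      refine (hF (homOfLE (hik.trans h))).2 _ ?_
      rintro ⟨x, hx⟩
      refine hy ⟨x, ?_⟩
      rw [← hw (homOfLE (hik.trans h)), hx, hw]

variable [SuccOrder J] [OrderBot J] [WellFoundedLT J] [F.IsWellOrderContinuous]

lemma closedT1Inclusions_map
    (hF : ∀ j : J, ¬ IsMax j → closedT1Inclusions (F.map (homOfLE (Order.le_succ j))))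
    ⦃i j : J⦄ (φ : i ⟶ j) : closedT1Inclusions (F.map φ) := by
  induction j using SuccOrder.limitRecOn generalizing i with
  | isMin j hj =>
    obtain rfl : i = j := le_antisymm (leOfHom φ) (hj (leOfHom φ))
    obtain rfl : φ = 𝟙 _ := Subsingleton.elim _ _
    rw [F.map_id]
    exact closedT1Inclusions_of_isIso _
  | succ j hj ih =>
    obtain h | h := (leOfHom φ).eq_or_lt
    · obtain rfl := h
      obtain rfl : φ = 𝟙 _ := Subsingleton.elim _ _
      rw [F.map_id]
      exact closedT1Inclusions_of_isIso _
    · obtain rfl : φ = homOfLE ((Order.lt_succ_iff_of_not_isMax hj).1 h) ≫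
        homOfLE (Order.le_succ j) := Subsingleton.elim _ _
      rw [F.map_comp]
      exact MorphismProperty.comp_mem _ _ _ (ih _) (hF j hj)
  | isSuccLimit j hj ih =>
    obtain h | h := (leOfHom φ).eq_or_lt
    · obtain rfl := h
      obtain rfl : φ = 𝟙 _ := Subsingleton.elim _ _
      rw [F.map_id]
      exact closedT1Inclusions_of_isIso _
    · have : Nonempty (Set.Iio j) := ⟨⟨i, h⟩⟩
      exact closedT1Inclusions_ι_app (fun a b ψ => ih b.1 b.2 _)
        (F.isColimitOfIsWellOrderContinuous j hj) ⟨i, h⟩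

lemma closedT1Inclusions_of_transfiniteComposition {X Y : TopCat.{u}} {f : X ⟶ Y}
    (h : closedT1Inclusions.TransfiniteCompositionOfShape J f) : closedT1Inclusions f := by
  have := closedT1Inclusions_ι_app (closedT1Inclusions_map h.map_mem) h.isColimit ⊥
  rw [← h.fac]
  exact MorphismProperty.comp_mem _ _ _ (closedT1Inclusions_of_isIso _) this

instance : MorphismProperty.IsStableUnderTransfiniteComposition.{u} closedT1Inclusions.{u} where
  isStableUnderTransfiniteCompositionOfShape _ _ _ _ _ :=
    ⟨fun _ _ _ ⟨h⟩ => closedT1Inclusions_of_transfiniteComposition h⟩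

lemma isClosed_of_subset_range_of_closedT1Inclusions
    (hF : ∀ j : J, ¬ IsMax j → closedT1Inclusions (F.map (homOfLE (Order.le_succ j))))
    {c : Cocone F} (hc : IsColimit c) {α : ℕ → J} (hα : StrictMono α) {x : ℕ → c.pt}
    (hx : ∀ n, x n ∈ range (c.ι.app (α (n + 1)))) (hx' : ∀ n, x n ∉ range (c.ι.app (α n)))
    {S : Set c.pt} (hS : S ⊆ range x) : IsClosed S := by
  have hι := closedT1Inclusions_ι_app (closedT1Inclusions_map hF) hc
  have hw : ∀ {i j : J} (φ : i ⟶ j) (x : F.obj i), c.ι.app j (F.map φ x) = c.ι.app i x :=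
    fun φ x => ConcreteCategory.congr_hom (c.w φ) x
  have hmono : ∀ {i j : J}, i ≤ j → range (c.ι.app i) ⊆ range (c.ι.app j) := by
    rintro i j h _ ⟨z, rfl⟩
    exact ⟨F.map (homOfLE h) z, hw _ _⟩
  have hfin : ∀ (n : ℕ), IsClosed (S ∩ x '' Iio n) := by
    intro n
    have hT : (S ∩ x '' Iio n).Finite := ((finite_Iio n).image x).inter_of_right S
    rw [← biUnion_of_singleton (S ∩ x '' Iio n)]
    refine hT.isClosed_biUnion fun y hy => ?_
    obtain ⟨m, -, rfl⟩ := hy.2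
    exact (hι (α m)).2 _ (hx' m)
  have hlow : ∀ (j : J) (n : ℕ), j ≤ α n → IsClosed (c.ι.app j ⁻¹' S) := by
    intro j n hjn
    have : c.ι.app j ⁻¹' S = c.ι.app j ⁻¹' (S ∩ x '' Iio n) := by
      ext z
      refine ⟨fun hz => ⟨hz, ?_⟩, fun hz => hz.1⟩
      obtain ⟨m, hm⟩ := hS hz
      refine ⟨m, mem_Iio.2 (lt_of_not_ge fun hnm => hx' m ?_), hm⟩
      rw [hm]
      exact hmono (hjn.trans (hα.monotone hnm)) ⟨z, rfl⟩
    rw [this]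
    exact (hfin n).preimage (c.ι.app j).hom.continuous
  by_cases hb : ∃ i, ∀ n, α n ≤ i
  · obtain ⟨i, hi, hmin⟩ : ∃ i, (∀ n, α n ≤ i) ∧ ∀ k, (∀ n, α n ≤ k) → i ≤ k :=
      ⟨_, WellFounded.min_mem (wellFounded_lt (α := J)) {i | ∀ n, α n ≤ i} hb,
        fun k hk => not_lt.1 (WellFounded.not_lt_min (wellFounded_lt (α := J))
          {i | ∀ n, α n ≤ i} hk)⟩
    have hlim : Order.IsSuccLimit i := by
      refine ⟨fun h => ?_, fun a ha => ?_⟩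
      · exact absurd ((hα zero_lt_one).trans_le (hi 1)) (not_lt.2 (h (hi 0)))
      · obtain ⟨n, hn⟩ : ∃ n, a < α n := by
          by_contra! hcon
          exact absurd ha.1 (not_lt.2 (hmin a hcon))
        exact ha.2 hn ((hα n.lt_succ_self).trans_le (hi _))
    have hcl : IsClosed (c.ι.app i ⁻¹' S) := by
      refine (isClosed_iff_of_isColimit _ (F.isColimitOfIsWellOrderContinuous i hlim) _).2 ?_
      rintro ⟨k, hk⟩
      obtain ⟨n, hn⟩ : ∃ n, k ≤ α n := by
        by_contra! hcon
        exact absurd hk (not_lt.2 (hmin k fun n => (hcon n).le))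
      have heq : F.map (homOfLE (le_of_lt hk)) ⁻¹' (c.ι.app i ⁻¹' S) = c.ι.app k ⁻¹' S := by
        ext z
        exact iff_of_eq (congrArg (· ∈ S) (hw _ _))
      have h := hlow k n hn
      rwa [← heq] at h
    have : S = c.ι.app i '' (c.ι.app i ⁻¹' S) := by
      rw [image_preimage_eq_of_subset]
      intro y hy
      obtain ⟨m, rfl⟩ := hS hy
      exact hmono (hi _) (hx m)
    rw [this]
    exact (hι i).1.isClosedMap _ hcl
  · push Not at hb
    rw [isClosed_iff_of_isColimit c hc]
    intro j
    obtain ⟨n, hn⟩ := hb j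
    exact hlow j n hn.le

lemma exists_range_subset_of_compactSpace
    (hF : ∀ j : J, ¬ IsMax j → closedT1Inclusions (F.map (homOfLE (Order.le_succ j))))
    {c : Cocone F} (hc : IsColimit c) {K : TopCat.{u}} [CompactSpace K] (f : K ⟶ c.pt) :
    ∃ j, range f ⊆ range (c.ι.app j) := by
  have hw : ∀ {i j : J} (φ : i ⟶ j) (x : F.obj i), c.ι.app j (F.map φ x) = c.ι.app i x :=
    fun φ x => ConcreteCategory.congr_hom (c.w φ) x
  have hmono : ∀ {i j : J}, i ≤ j → range (c.ι.app i) ⊆ range (c.ι.app j) := by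
    rintro i j h _ ⟨z, rfl⟩
    exact ⟨F.map (homOfLE h) z, hw _ _⟩
  by_contra! hcon
  have hstep : ∀ j : J, ∃ (k : K) (j' : J), j < j' ∧ f k ∉ range (c.ι.app j) ∧
      f k ∈ range (c.ι.app j') := by
    intro j
    obtain ⟨_, ⟨k, rfl⟩, hk⟩ := not_subset.1 (hcon j)
    obtain ⟨j', z, hz⟩ := Types.jointly_surjective_of_isColimit
      (isColimitOfPreserves (forget TopCat) hc) (f k)
    have hk' : f k ∈ range (c.ι.app j') := ⟨z, hz⟩
    exact ⟨k, j', lt_of_not_ge fun h => hk (hmono h hk'), hk, hk'⟩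
  choose k next hlt hk hk' using hstep
  let α : ℕ → J := fun n => next^[n] ⊥
  have hsucc : ∀ n, α (n + 1) = next (α n) := fun n => Function.iterate_succ_apply' _ _ _
  have hα : StrictMono α := strictMono_nat_of_lt_succ fun n => by
    rw [hsucc]
    exact hlt _
  let x : ℕ → c.pt := fun n => f (k (α n))
  have hx : ∀ n, x n ∈ range (c.ι.app (α (n + 1))) := fun n => by
    rw [hsucc]
    exact hk' _
  have hx' : ∀ n, x n ∉ range (c.ι.app (α n)) := fun n => hk _
  obtain ⟨z, hz⟩ := IsCompact.nonempty_iInter_of_sequence_nonempty_isCompact_isClosed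
    (fun n => f ⁻¹' (x '' Ici n))
    (fun n => preimage_mono (image_mono (Ici_subset_Ici.2 n.le_succ)))
    (fun n => ⟨k (α n), n, self_mem_Ici, rfl⟩)
    (IsClosed.isCompact ((isClosed_of_subset_range_of_closedT1Inclusions hF hc hα hx hx'
      (image_subset_range _ _)).preimage f.hom.continuous))
    (fun n => (isClosed_of_subset_range_of_closedT1Inclusions hF hc hα hx hx'
      (image_subset_range _ _)).preimage f.hom.continuous)
  rw [mem_iInter] at hz
  obtain ⟨m, -, hm⟩ := hz 0
  obtain ⟨m', hmm', hm'⟩ := hz (m + 1)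
  refine hx' m' (hmono (hα.monotone hmm') ?_)
  rw [hm', ← hm]
  exact hx m

lemma preservesColimit_coyoneda_of_compactSpace
    (hF : ∀ j : J, ¬ IsMax j → closedT1Inclusions (F.map (homOfLE (Order.le_succ j))))
    (K : TopCat.{u}) [CompactSpace K] :
    PreservesColimit F (coyoneda.obj (Opposite.op K)) where
  preserves {c} hc := by
    have hι := closedT1Inclusions_ι_app (closedT1Inclusions_map hF) hc
    refine ⟨Types.FilteredColimit.isColimitOf' _ _ (fun (f : K ⟶ c.pt) => ?_)
      fun i (g g' : K ⟶ F.obj i) (h : g ≫ c.ι.app i = g' ≫ c.ι.app i) => ⟨i, 𝟙 i, ?_⟩⟩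
    · obtain ⟨j, hj⟩ := exists_range_subset_of_compactSpace hF hc f
      choose g hg using fun k => hj (mem_range_self k)
      have hfg : c.ι.app j ∘ g = f := funext hg
      have hcont : Continuous g := by
        rw [(hι j).1.isInducing.continuous_iff, hfg]
        exact f.hom.continuous
      have hfac : f = ofHom ⟨g, hcont⟩ ≫ c.ι.app j := by
        ext k
        exact (hg k).symm
      exact ⟨j, ofHom ⟨g, hcont⟩, hfac⟩
    · have : g = g' := by
        ext k
        exact (hι i).1.injective (ConcreteCategory.congr_hom h k)
      rw [this]

end Sequence

end TopCat

/-! ### Classes of morphisms in under categories -/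

namespace CategoryTheory.Under

variable {C : Type u} [Category.{v} C] {B : C} (W : MorphismProperty C)

instance isConnected_walkingSpan : IsConnected WalkingSpan :=
  zigzag_isConnected fun j₁ j₂ => by
    have h : ∀ j, Zigzag WalkingSpan.zero j := fun j => by
      rcases j with _ | _ | _
      · exact Zigzag.refl _
      · exact Zigzag.of_hom WalkingSpan.Hom.fst
      · exact Zigzag.of_hom WalkingSpan.Hom.snd
    exact (h j₁).symm.trans (h j₂)

instance [W.IsStableUnderCobaseChange] :
    (W.inverseImage (Under.forget B)).IsStableUnderCobaseChange where
  of_isPushout sq h := W.of_isPushout (sq.map (Under.forget B)) h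

attribute [local instance] IsFiltered.isConnected

instance (J : Type w) [LinearOrder J] : PreservesWellOrderContinuousOfShape J (Under.forget B) :=
  ⟨fun _ hj => by
    have : Nonempty (Set.Iio _) := hj.nonempty_Iio.to_subtype
    infer_instance⟩

instance [MorphismProperty.IsStableUnderTransfiniteComposition.{w} W] :
    MorphismProperty.IsStableUnderTransfiniteComposition.{w}
      (W.inverseImage (Under.forget B)) where
  isStableUnderTransfiniteCompositionOfShape _ _ _ _ _ :=
    ⟨fun _ _ _ ⟨h⟩ => by
      exact W.transfiniteCompositionsOfShape_le _ _ ⟨h.map⟩⟩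

lemma isPushout_sigmaMap {J : Type w} {X₁ X₂ : J → Under B} [HasCoproduct X₁] [HasCoproduct X₂]
    [HasCoproduct fun j => (X₁ j).right] [HasCoproduct fun j => (X₂ j).right]
    (f : ∀ j, X₁ j ⟶ X₂ j) :
    IsPushout (Limits.Sigma.map fun j => (f j).right)
      (Limits.Sigma.desc fun j => (Sigma.ι X₁ j).right)
      (Limits.Sigma.desc fun j => (Sigma.ι X₂ j).right) (Limits.Sigma.map f).right := by
  have hι : ∀ j, (f j).right ≫ (Sigma.ι X₂ j).right =
      (Sigma.ι X₁ j).right ≫ (Limits.Sigma.map f).right := fun j => by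
    rw [← Under.comp_right, ← Under.comp_right, Limits.Sigma.ι_map]
  have hexists : ∀ {Z : C} (a : (∐ fun j => (X₂ j).right) ⟶ Z) (b : (∐ X₁).right ⟶ Z)
      (_ : Limits.Sigma.map (fun j => (f j).right) ≫ a =
        Limits.Sigma.desc (fun j => (Sigma.ι X₁ j).right) ≫ b),
      ∃ k : (∐ X₂).right ⟶ Z, Limits.Sigma.desc (fun j => (Sigma.ι X₂ j).right) ≫ k = a ∧
        (Limits.Sigma.map f).right ≫ k = b := by
    intro Z a b hab
    have hab' : ∀ j, (f j).right ≫ Sigma.ι (fun j => (X₂ j).right) j ≫ a =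
        (Sigma.ι X₁ j).right ≫ b := fun j => by
      simpa using Sigma.ι (fun j => (X₁ j).right) j ≫= hab
    let Z' : Under B := Under.mk ((∐ X₁).hom ≫ b)
    let b' : ∐ X₁ ⟶ Z' := Under.homMk b
    let a' : ∀ j, X₂ j ⟶ Z' := fun j =>
      Under.homMk (Sigma.ι (fun j => (X₂ j).right) j ≫ a) (by
        rw [← Under.w (f j), Category.assoc, hab', ← Category.assoc, Under.w]
        rfl)
    have hab'' : Limits.Sigma.map f ≫ Limits.Sigma.desc a' = b' := by
      apply Limits.Sigma.hom_ext
      intro j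
      rw [Limits.Sigma.ι_map_assoc, Limits.Sigma.ι_desc]
      ext
      exact hab' j
    refine ⟨(Limits.Sigma.desc a').right, ?_, congrArg CommaMorphism.right hab''⟩
    apply Limits.Sigma.hom_ext
    intro j
    rw [Limits.Sigma.ι_desc_assoc, ← Under.comp_right, Limits.Sigma.ι_desc]
    rfl
  have hunique : ∀ {Z : C} (k k' : (∐ X₂).right ⟶ Z)
      (_ : Limits.Sigma.desc (fun j => (Sigma.ι X₂ j).right) ≫ k =
        Limits.Sigma.desc (fun j => (Sigma.ι X₂ j).right) ≫ k')
      (_ : (Limits.Sigma.map f).right ≫ k = (Limits.Sigma.map f).right ≫ k'), k = k' := by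
    intro Z k k' h h'
    let Z' : Under B := Under.mk ((∐ X₂).hom ≫ k)
    let l : ∐ X₂ ⟶ Z' := Under.homMk k
    let l' : ∐ X₂ ⟶ Z' := Under.homMk k' (by
      rw [← Under.w (Limits.Sigma.map f), Category.assoc, ← h', ← Category.assoc, Under.w]
      rfl)
    refine congrArg CommaMorphism.right (show l = l' from ?_)
    apply Limits.Sigma.hom_ext
    intro j
    ext
    have := Sigma.ι (fun j => (X₂ j).right) j ≫= h
    rwa [Limits.Sigma.ι_desc_assoc, Limits.Sigma.ι_desc_assoc] at this
  choose k hk hk' using @hexists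
  refine ⟨⟨by
    apply Limits.Sigma.hom_ext
    intro j
    simpa using hι j⟩, ⟨PushoutCocone.IsColimit.mk _ (fun s => k s.inl s.inr s.condition)
      (fun s => hk _ _ _) (fun s => hk' _ _ _)
      fun s m hm hm' => hunique _ _ ?_ ?_⟩⟩
  · rw [hm, hk]
  · rw [hm', hk']

instance [HasCoproducts.{w} C] [W.IsStableUnderCobaseChange]
    [MorphismProperty.IsStableUnderCoproducts.{w} W] :
    MorphismProperty.IsStableUnderCoproducts.{w} (W.inverseImage (Under.forget B)) where
  isStableUnderCoproductsOfShape _ :=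
    .mk _ _ fun _ _ _ _ f hf => W.of_isPushout (isPushout_sigmaMap f).flip
      (MorphismProperty.colimMap _ fun ⟨j⟩ => hf j)

end CategoryTheory.Under

namespace NumericallyGenerated

open Topology Set TopCat

/-! ### Compact spaces are small relative to closed `T₁` inclusions -/

/-- The functor which adds a base point is left adjoint to the forgetful functor. -/
def addPointAdjunction : addPoint.{u} ⊣ Under.forget pt.{u} :=
  Adjunction.mkOfHomEquiv
    { homEquiv X Y :=
        { toFun f := TopCat.ofHom ⟨Sum.inl, continuous_inl⟩ ≫ f.right
          invFun f := Under.homMk (TopCat.ofHom ⟨Sum.elim f Y.hom,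
            f.hom.continuous.sumElim Y.hom.hom.continuous⟩) (by ext; rfl)
          left_inv f := by
            ext x
            rcases x with x | x
            · rfl
            · exact (ConcreteCategory.congr_hom (Under.w f) x).symm
          right_inv f := rfl }
      homEquiv_naturality_left_symm f g := by
        ext x
        rcases x with x | x <;> rfl
      homEquiv_naturality_right f g := rfl }

/-- The pointed maps whose underlying map is a closed `T₁` inclusion. -/
abbrev pointedClosedT1Inclusions : MorphismProperty PointedTop.{u} :=
  closedT1Inclusions.{u}.inverseImage (Under.forget pt.{u})

lemma pointedClosedT1Inclusions_addPoint_map {X Y : TopCat.{u}} {f : X ⟶ Y}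
    (hf : closedT1Inclusions f) : pointedClosedT1Inclusions (addPoint.map f) := by
  refine ⟨.of_continuous_injective_isClosedMap (addPoint.map f).right.hom.continuous
    (Sum.map_injective.2 ⟨hf.1.injective, Function.injective_id⟩) ?_, ?_⟩
  · exact isClosedMap_sum.2 ⟨isClosedMap_inl.comp hf.1.isClosedMap, isClosedMap_inr⟩
  · rintro (y | y) hy
    · have hy' : y ∉ range f := by
        rintro ⟨x, rfl⟩
        exact hy ⟨Sum.inl x, rfl⟩
      have := (isClosedMap_inl (Y := PUnit.{u + 1})) _ (hf.2 y hy')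
      rwa [image_singleton] at this
    · exact (hy ⟨Sum.inr y, rfl⟩).elim

lemma closedT1Inclusions_of_injective {X Y : TopCat.{u}} [CompactSpace X] [T2Space Y] (f : X ⟶ Y)
    (hf : Function.Injective f) : closedT1Inclusions f :=
  ⟨f.hom.continuous.isClosedEmbedding hf, fun _ _ => isClosed_singleton⟩

instance (n : ℕ) : CompactSpace (diskBoundary.{u} n) :=
  inferInstanceAs (CompactSpace (ULift (Metric.sphere (0 : EuclideanSpace ℝ (Fin n)) 1)))

instance (n : ℕ) : CompactSpace (disk.{u} n) :=
  inferInstanceAs (CompactSpace (ULift (Metric.closedBall (0 : EuclideanSpace ℝ (Fin n)) 1)))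

instance (n : ℕ) : T2Space (disk.{u} n) :=
  inferInstanceAs (T2Space (ULift (Metric.closedBall (0 : EuclideanSpace ℝ (Fin n)) 1)))

instance : CompactSpace TopCat.I.{u} :=
  inferInstanceAs (CompactSpace (ULift unitInterval))

instance : T2Space TopCat.I.{u} :=
  inferInstanceAs (T2Space (ULift unitInterval))

instance (n : ℕ) : CompactSpace (diskCylinder.{u} n) :=
  inferInstanceAs (CompactSpace (disk.{u} n × TopCat.I.{u}))

instance (n : ℕ) : T2Space (diskCylinder.{u} n) :=
  inferInstanceAs (T2Space (disk.{u} n × TopCat.I.{u}))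

lemma genCofTop_le : genCofTop.{u} ≤ pointedClosedT1Inclusions := by
  rintro _ _ _ ⟨n⟩
  refine pointedClosedT1Inclusions_addPoint_map (closedT1Inclusions_of_injective _ ?_)
  rintro ⟨x⟩ ⟨y⟩ h
  exact congrArg ULift.up (Subtype.ext (congrArg (fun z => (ULift.down z).1) h))

lemma genTrivCofTop_le : genTrivCofTop.{u} ≤ pointedClosedT1Inclusions := by
  rintro _ _ _ ⟨n⟩
  exact pointedClosedT1Inclusions_addPoint_map (closedT1Inclusions_of_injective _
    fun x y h => congrArg Prod.fst h)

attribute [local instance] IsFiltered.isConnected in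
lemma preservesColimit_coyoneda_addPoint {J : Type u} [LinearOrder J] [SuccOrder J] [OrderBot J]
    [WellFoundedLT J] (F : J ⥤ PointedTop.{u}) [F.IsWellOrderContinuous]
    (hF : ∀ j : J, ¬ IsMax j →
      pointedClosedT1Inclusions (F.map (homOfLE (Order.le_succ j))))
    (K : TopCat.{u}) [CompactSpace K] :
    PreservesColimit F (coyoneda.obj (Opposite.op (addPoint.obj K))) := by
  have : PreservesColimit (F ⋙ Under.forget pt) (coyoneda.obj (Opposite.op K)) :=
    preservesColimit_coyoneda_of_compactSpace hF K
  exact preservesColimit_of_natIso F (addPointAdjunction.corepresentableBy K).toIso.symm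

end NumericallyGenerated

namespace CategoryTheory.MorphismProperty

/-! ### Inverse images of classes of morphisms under cocontinuous functors -/

variable {C : Type u} [Category.{v} C] {D : Type u'} [Category.{v'} D] (W : MorphismProperty D)
  (F : C ⥤ D)

lemma IsStableUnderCobaseChange.inverseImage_of_preservesColimits
    [PreservesColimitsOfShape WalkingSpan F] [W.IsStableUnderCobaseChange] :
    (W.inverseImage F).IsStableUnderCobaseChange where
  of_isPushout sq h := W.of_isPushout (sq.map F) h

lemma IsStableUnderTransfiniteComposition.inverseImage_of_preservesColimits
    [PreservesColimitsOfSize.{w, w} F] [IsStableUnderTransfiniteComposition.{w} W] :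
    IsStableUnderTransfiniteComposition.{w} (W.inverseImage F) where
  isStableUnderTransfiniteCompositionOfShape J _ _ _ _ :=
    ⟨fun _ _ _ ⟨h⟩ => by
      have : PreservesWellOrderContinuousOfShape J F := ⟨fun _ _ => inferInstance⟩
      exact W.transfiniteCompositionsOfShape_le J _ ⟨h.map⟩⟩

lemma IsStableUnderCoproducts.inverseImage_of_preservesColimits
    [PreservesColimitsOfSize.{w, w} F] [IsStableUnderCoproducts.{w} W] :
    IsStableUnderCoproducts.{w} (W.inverseImage F) where
  isStableUnderCoproductsOfShape J :=
    ⟨fun _ _ _ _ hc₁ hc₂ f hf φ hφ =>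
      W.colimitsOfShape_le (J := Discrete J) _
        (.mk' _ _ _ _ (isColimitOfPreserves F hc₁) (isColimitOfPreserves F hc₂)
          (Functor.whiskerRight f F) hf (F.map φ)
          fun j => (F.map_comp _ _).symm.trans ((congrArg F.map (hφ j)).trans (F.map_comp _ _)))⟩

end CategoryTheory.MorphismProperty

namespace NumericallyGenerated

/-! ### Numerically generated spaces form a coreflective subcategory -/

/-- The underlying set of a space, with the topology of numerically open subsets. -/
def Numericalization (X : Type u) : Type u := X

namespace Numericalization

/-- The identity map from a set to its numericalization. -/
def mk {X : Type u} (x : X) : Numericalization X := x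

/-- The identity map from the numericalization of a set. -/
def val {X : Type u} (x : Numericalization X) : X := x

variable {X : Type u} [TopologicalSpace X]

instance : TopologicalSpace (Numericalization X) where
  IsOpen U := IsNumericallyOpen (mk ⁻¹' U)
  isOpen_univ _ _ _ _ := isOpen_univ
  isOpen_inter _ _ hs ht n V hV P := (hs n V hV P).inter (ht n V hV P)
  isOpen_sUnion S hS n V hV P := by
    rw [Set.preimage_sUnion, Set.preimage_iUnion₂]
    exact isOpen_biUnion fun s hs => hS s hs n V hV P

lemma isOpen_iff {U : Set (Numericalization X)} : IsOpen U ↔ IsNumericallyOpen (mk ⁻¹' U) :=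
  Iff.rfl

lemma continuous_val : Continuous (val (X := X)) where
  isOpen_preimage _ hU := isOpen_iff.2 fun _ _ _ P => hU.preimage P.continuous

lemma continuous_mk {A : Type u} [TopologicalSpace A] (hA : IsNumericallyGenerated A)
    {f : A → X} (hf : Continuous f) : Continuous fun a => mk (f a) where
  isOpen_preimage _ hU := hA _ (IsNumericallyOpen.preimage (isOpen_iff.1 hU) ⟨f, hf⟩)

lemma continuous_mk_of_isOpen {n : ℕ} {V : Set (EuclideanSpace ℝ (Fin n))} (hV : IsOpen V)
    (P : C(V, X)) : Continuous fun a => mk (P a) where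
  isOpen_preimage _ hU := isOpen_iff.1 hU n V hV P

lemma isNumericallyGenerated : IsNumericallyGenerated (Numericalization X) :=
  fun _ hU => isOpen_iff.2 fun n V hV P => hU n V hV ⟨_, continuous_mk_of_isOpen hV P⟩

end Numericalization

open Numericalization

/-- The right adjoint of the inclusion of numerically generated spaces. -/
def numericalization : TopCat.{u} ⥤ NG.{u} where
  obj X := ⟨TopCat.of (Numericalization X), isNumericallyGenerated (X := X)⟩
  map {X Y} f := ObjectProperty.homMk (TopCat.ofHom (X := Numericalization X)
    (Y := Numericalization Y) ⟨fun x => mk (f (val (X := X) x)),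
    continuous_mk (X := Y) (isNumericallyGenerated (X := X))
      (f.hom.continuous.comp (continuous_val (X := X)))⟩)

/-- The coreflection of spaces onto numerically generated spaces. -/
def inclusionAdjunction : inclusion.{u} ⊣ numericalization.{u} :=
  Adjunction.mkOfHomEquiv
    { homEquiv X _ :=
        { toFun f := ObjectProperty.homMk (TopCat.ofHom ⟨fun x => mk (f x),
            continuous_mk X.property f.hom.continuous⟩)
          invFun f := TopCat.ofHom ⟨fun x => val (f.hom x),
            continuous_val.comp f.hom.hom.continuous⟩
          left_inv _ := rfl
          right_inv _ := rfl }
      homEquiv_naturality_left_symm _ _ := rfl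
      homEquiv_naturality_right _ _ := rfl }

instance : Coreflective inclusion.{u} where
  R := numericalization
  adj := inclusionAdjunction

instance : HasLimits NG.{u} := hasLimits_of_coreflective inclusion

instance : HasColimits NG.{u} := hasColimits_of_coreflective inclusion

instance : pointedInclusion.{u}.Full :=
  inferInstanceAs (Under.post (X := ptNG.{u}) inclusion.{u}).Full

instance : pointedInclusion.{u}.Faithful :=
  inferInstanceAs (Under.post (X := ptNG.{u}) inclusion.{u}).Faithful

/-- The right adjoint of the inclusion of pointed numerically generated spaces. -/
def pointedNumericalization : PointedTop.{u} ⥤ PointedNG.{u} :=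
  Under.post numericalization ⋙ Under.map (inclusionAdjunction.unit.app ptNG)

/-- The coreflection of pointed spaces onto pointed numerically generated spaces. -/
def pointedInclusionAdjunction : pointedInclusion.{u} ⊣ pointedNumericalization.{u} :=
  Under.postAdjunctionLeft inclusionAdjunction

instance : pointedInclusion.{u}.IsLeftAdjoint := ⟨_, ⟨pointedInclusionAdjunction⟩⟩

instance : HasLimits PointedNG.{u} := inferInstance
instance : HasColimits PointedNG.{u} := inferInstance
instance : HasLimits PointedTop.{u} := inferInstance
instance : HasColimits PointedTop.{u} := inferInstance

end NumericallyGenerated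

namespace NumericallyGenerated

open BallHomotopy TopCat Set

/-! ### Lifting properties with respect to the generating maps -/

/-- The radial retraction of a Euclidean space onto the disk. -/
noncomputable def diskRetraction (n : ℕ) : C(EuclideanSpace ℝ (Fin n), disk.{u} n) where
  toFun x := ULift.up (ballRetraction n x)
  continuous_toFun := continuous_uliftUp.comp (ballRetraction n).continuous

/-- The inclusion of the disk in a Euclidean space. -/
noncomputable def diskVal (n : ℕ) : C(disk.{u} n, EuclideanSpace ℝ (Fin n)) where
  toFun x := (ULift.down x).1
  continuous_toFun := continuous_subtype_val.comp continuous_uliftDown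

lemma diskVal_mem {n : ℕ} (x : disk.{u} n) : diskVal n x ∈ unitBall (EuclideanSpace ℝ (Fin n)) :=
  (ULift.down x).2

@[simp]
lemma diskRetraction_diskVal {n : ℕ} (x : disk.{u} n) : diskRetraction n (diskVal n x) = x :=
  congrArg ULift.up (ballRetraction_coe n (ULift.down x))

lemma diskVal_diskRetraction {n : ℕ} {x : EuclideanSpace ℝ (Fin n)}
    (hx : x ∈ unitBall (EuclideanSpace ℝ (Fin n))) : diskVal.{u} n (diskRetraction n x) = x :=
  congrArg Subtype.val (ballRetraction_coe n ⟨x, hx⟩)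

lemma diskRetraction_eq {n : ℕ} {x : EuclideanSpace ℝ (Fin n)}
    (hx : x ∈ unitBall (EuclideanSpace ℝ (Fin n))) :
    diskRetraction.{u} n x = ULift.up ⟨x, hx⟩ :=
  congrArg ULift.up (ballRetraction_coe n ⟨x, hx⟩)

variable {X Y : TopCat.{u}} (p : X ⟶ Y)

lemma sphereLifting_of_hasLiftingProperty {n : ℕ}
    [HasLiftingProperty (diskBoundaryInclusion.{u} n) p] :
    SphereLifting (EuclideanSpace ℝ (Fin n)) p := by
  intro a b ha hb hab
  let f : diskBoundary.{u} n ⟶ X := ofHom ⟨fun x => a (ULift.down x).1,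
    (continuousOn_iff_continuous_domRestrict.1 ha).comp continuous_uliftDown⟩
  let g : disk.{u} n ⟶ Y := ofHom ⟨fun x => b (diskVal n x),
    hb.comp_continuous (diskVal n).continuous diskVal_mem⟩
  have sq : CommSq f (diskBoundaryInclusion n) p g := ⟨by
    ext x
    exact hab _ (ULift.down x).2⟩
  refine ⟨fun x => sq.lift (diskRetraction n x),
    (sq.lift.hom.continuous.comp (diskRetraction n).continuous).continuousOn,
    fun x hx => ?_, fun x hx => ?_⟩
  · change sq.lift (diskRetraction n x) = a x
    rw [diskRetraction_eq (sphere_subset_ball hx)]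
    exact ConcreteCategory.congr_hom sq.fac_left (ULift.up ⟨x, hx⟩)
  · refine (ConcreteCategory.congr_hom sq.fac_right (diskRetraction n x)).trans ?_
    exact congrArg b (diskVal_diskRetraction hx)

lemma surjective_of_hasLiftingProperty [HasLiftingProperty (diskBoundaryInclusion.{u} 0) p] :
    Function.Surjective p := by
  intro y
  have h : ∀ x : diskBoundary.{u} 0, False := fun x =>
    unitSphere_eq_empty_of_subsingleton _ (ULift.down x).2
  let f : diskBoundary.{u} 0 ⟶ X := ofHom ⟨fun x => (h x).elim,
    continuous_iff_continuousAt.2 fun x => (h x).elim⟩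
  let g : disk.{u} 0 ⟶ Y := ofHom ⟨fun _ => y, continuous_const⟩
  have sq : CommSq f (diskBoundaryInclusion 0) p g := ⟨by
    ext x
    exact (h x).elim⟩
  exact ⟨sq.lift (diskRetraction 0 0), ConcreteCategory.congr_hom sq.fac_right _⟩

lemma hasLiftingProperty_of_sphereLifting (hp : Function.Surjective p) {n : ℕ}
    (h : SphereLifting (EuclideanSpace ℝ (Fin n)) p) :
    HasLiftingProperty (diskBoundaryInclusion.{u} n) p where
  sq_hasLift {f g} sq := by
    classical
    obtain ⟨x₀, -⟩ := hp (g (diskRetraction n 0))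
    let a : EuclideanSpace ℝ (Fin n) → X := fun x =>
      if hx : x ∈ unitSphere (EuclideanSpace ℝ (Fin n)) then f (ULift.up ⟨x, hx⟩) else x₀
    have ha : ∀ x (hx : x ∈ unitSphere (EuclideanSpace ℝ (Fin n))),
        a x = f (ULift.up ⟨x, hx⟩) := fun x hx => dif_pos hx
    have ha' : ContinuousOn a (unitSphere (EuclideanSpace ℝ (Fin n))) := by
      rw [continuousOn_iff_continuous_domRestrict]
      have : (unitSphere (EuclideanSpace ℝ (Fin n))).domRestrict a =
          fun x => f (ULift.up x) := funext fun x => ha x.1 x.2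
      rw [this]
      exact f.hom.continuous.comp continuous_uliftUp
    obtain ⟨k, hk, hk1, hk2⟩ := h a (fun x => g (diskRetraction n x)) ha'
      (g.hom.continuous.comp (diskRetraction n).continuous).continuousOn (fun x hx => by
        rw [ha x hx, diskRetraction_eq (sphere_subset_ball hx)]
        exact ConcreteCategory.congr_hom sq.w (ULift.up ⟨x, hx⟩))
    refine ⟨⟨ofHom ⟨fun x => k (diskVal n x),
      hk.comp_continuous (diskVal n).continuous diskVal_mem⟩, ?_, ?_⟩⟩
    · ext ⟨x⟩
      exact (hk1 x.1 x.2).trans (ha x.1 x.2)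
    · ext x
      refine (hk2 _ (diskVal_mem x)).trans ?_
      rw [diskRetraction_diskVal]

/-- The retraction of `ℝⁿ × ℝ` onto the cylinder `Dⁿ × [0, 1]`. -/
noncomputable def cylinderRetraction (n : ℕ) :
    C(EuclideanSpace ℝ (Fin n) × ℝ, diskCylinder.{u} n) where
  toFun x := (diskRetraction n x.1, ULift.up (Set.projIcc (0 : ℝ) 1 zero_le_one x.2))
  continuous_toFun := ((diskRetraction n).continuous.comp continuous_fst).prodMk
    (continuous_uliftUp.comp (continuous_projIcc.comp continuous_snd))

/-- The inclusion of the cylinder `Dⁿ × [0, 1]` in `ℝⁿ × ℝ`. -/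
noncomputable def cylinderVal (n : ℕ) :
    C(diskCylinder.{u} n, EuclideanSpace ℝ (Fin n) × ℝ) where
  toFun x := (diskVal n x.1, (ULift.down x.2).1)
  continuous_toFun := ((diskVal n).continuous.comp continuous_fst).prodMk
    (continuous_subtype_val.comp (continuous_uliftDown.comp continuous_snd))

lemma cylinderVal_mem {n : ℕ} (x : diskCylinder.{u} n) :
    cylinderVal n x ∈ cylinder (EuclideanSpace ℝ (Fin n)) :=
  ⟨diskVal_mem x.1, (ULift.down x.2).2⟩

lemma cylinderRetraction_cylinderVal {n : ℕ} (x : diskCylinder.{u} n) :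
    cylinderRetraction n (cylinderVal n x) = x :=
  Prod.ext (diskRetraction_diskVal x.1)
    (congrArg ULift.up (Set.projIcc_val zero_le_one (ULift.down x.2)))

lemma cylinderVal_cylinderRetraction {n : ℕ} {x : EuclideanSpace ℝ (Fin n) × ℝ}
    (hx : x ∈ cylinder (EuclideanSpace ℝ (Fin n))) :
    cylinderVal.{u} n (cylinderRetraction n x) = x :=
  Prod.ext (diskVal_diskRetraction hx.1)
    (congrArg Subtype.val (Set.projIcc_val zero_le_one ⟨x.2, hx.2⟩))

lemma cylinderRetraction_zero {n : ℕ} (x : EuclideanSpace ℝ (Fin n)) :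
    cylinderRetraction.{u} n (x, 0) = diskCylinderInclusion n (diskRetraction n x) :=
  Prod.ext rfl (congrArg ULift.up (Set.projIcc_left zero_le_one))

lemma homotopyLifting_of_hasLiftingProperty {n : ℕ}
    [HasLiftingProperty (diskCylinderInclusion.{u} n) p] :
    HomotopyLifting (EuclideanSpace ℝ (Fin n)) p := by
  intro a H ha hH haH
  let f : disk.{u} n ⟶ X := ofHom ⟨fun x => a (diskVal n x),
    ha.comp_continuous (diskVal n).continuous diskVal_mem⟩
  let g : diskCylinder.{u} n ⟶ Y := ofHom ⟨fun x => H (cylinderVal n x),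
    hH.comp_continuous (cylinderVal n).continuous cylinderVal_mem⟩
  have sq : CommSq f (diskCylinderInclusion n) p g := ⟨by
    ext x
    exact (haH _ (diskVal_mem x)).symm⟩
  refine ⟨fun x => sq.lift (cylinderRetraction n x),
    (sq.lift.hom.continuous.comp (cylinderRetraction n).continuous).continuousOn,
    fun x hx => ?_, fun x hx => ?_⟩
  · change sq.lift (cylinderRetraction n (x, 0)) = a x
    rw [cylinderRetraction_zero]
    refine (ConcreteCategory.congr_hom sq.fac_left (diskRetraction n x)).trans ?_
    exact congrArg a (diskVal_diskRetraction hx)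
  · refine (ConcreteCategory.congr_hom sq.fac_right (cylinderRetraction n x)).trans ?_
    exact congrArg H (cylinderVal_cylinderRetraction hx)

lemma hasLiftingProperty_of_homotopyLifting {n : ℕ}
    (h : HomotopyLifting (EuclideanSpace ℝ (Fin n)) p) :
    HasLiftingProperty (diskCylinderInclusion.{u} n) p where
  sq_hasLift {f g} sq := by
    obtain ⟨K, hK, hK1, hK2⟩ := h (fun x => f (diskRetraction n x))
      (fun x => g (cylinderRetraction n x))
      (f.hom.continuous.comp (diskRetraction n).continuous).continuousOn
      (g.hom.continuous.comp (cylinderRetraction n).continuous).continuousOn (fun x _ => by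
        rw [cylinderRetraction_zero]
        exact (ConcreteCategory.congr_hom sq.w (diskRetraction n x)).symm)
    refine ⟨⟨ofHom ⟨fun x => K (cylinderVal n x),
      hK.comp_continuous (cylinderVal n).continuous cylinderVal_mem⟩, ?_, ?_⟩⟩
    · ext x
      refine (hK1 _ (diskVal_mem x)).trans ?_
      rw [diskRetraction_diskVal]
    · ext x
      refine (hK2 _ (cylinderVal_mem x)).trans ?_
      rw [cylinderRetraction_cylinderVal]

lemma rlp_ofHoms_addPoint_iff {ι : Type*} {A B : ι → TopCat.{u}} (i : ∀ n, A n ⟶ B n)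
    {X Y : PointedTop.{u}} (p : X ⟶ Y) :
    (MorphismProperty.ofHoms fun n => addPoint.map (i n)).rlp p ↔
      ∀ n, HasLiftingProperty (i n) p.right := by
  refine ⟨fun h n => (addPointAdjunction.hasLiftingProperty_iff _ _).1 (h _ ⟨n⟩), fun h => ?_⟩
  rintro _ _ _ ⟨n⟩
  exact (addPointAdjunction.hasLiftingProperty_iff _ _).2 (h n)

lemma rlp_genTrivCofTop_iff {X Y : PointedTop.{u}} (p : X ⟶ Y) :
    genTrivCofTop.rlp p ↔ ∀ n, HomotopyLifting (EuclideanSpace ℝ (Fin n)) p.right := by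
  refine (rlp_ofHoms_addPoint_iff _ _).trans ⟨fun h n => ?_, fun h n => ?_⟩
  · have := h n
    exact homotopyLifting_of_hasLiftingProperty _
  · exact hasLiftingProperty_of_homotopyLifting _ (h n)

lemma rlp_genCofTop_iff {X Y : PointedTop.{u}} (p : X ⟶ Y) :
    genCofTop.rlp p ↔ genTrivCofTop.rlp p ∧ weakEqTop p := by
  rw [rlp_genTrivCofTop_iff]
  refine Iff.trans ?_ (sphereLifting_iff p.right.hom)
  refine (rlp_ofHoms_addPoint_iff _ _).trans ⟨fun h => ⟨?_, fun n => ?_⟩, fun h n => ?_⟩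
  · have := h 0
    exact surjective_of_hasLiftingProperty _
  · have := h n
    exact sphereLifting_of_hasLiftingProperty _
  · exact hasLiftingProperty_of_sphereLifting _ h.1 (h.2 n)

end NumericallyGenerated

/-! ### Recognition of cofibrantly generated model structures -/

namespace ModelStructure

open MorphismProperty

section Recognition

variable {C : Type u} [Category.{v} C]

/-- `Hom(A, -)` commutes with all sequential colimits of morphisms in `K`. -/
def IsSequentiallySmallRel (K : MorphismProperty C) (A : C) : Prop :=
  ∀ (J : Type v) [LinearOrder J] [SuccOrder J] [OrderBot J] [WellFoundedLT J] [NoMaxOrder J]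
    (F : J ⥤ C) [F.IsWellOrderContinuous],
    (∀ j : J, K (F.map (homOfLE (Order.le_succ j)))) →
      PreservesColimit F (coyoneda.obj (Opposite.op A))

/-- The assumptions of the recognition theorem for finitely generated model structures with
generating cofibrations `I`, generating trivial cofibrations `J` and weak equivalences `W`; the
domains and codomains of the generators are small relative to a class `K` which contains the
relative cell complexes. -/
structure RecognitionData (I J W K : MorphismProperty C) : Prop where
  twoOutOfThree : W.HasTwoOutOfThreeProperty
  isSmall_left : MorphismProperty.IsSmall.{v} I
  isSmall_right : MorphismProperty.IsSmall.{v} J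
  isStableUnderCobaseChange : K.IsStableUnderCobaseChange
  isStableUnderCoproducts : IsStableUnderCoproducts.{v} K
  isStableUnderTransfiniteComposition : IsStableUnderTransfiniteComposition.{v} K
  left_le : I ≤ K
  right_le : J ≤ K
  small_left : ∀ ⦃A B : C⦄ (f : A ⟶ B), I f →
    IsSequentiallySmallRel K A ∧ IsSequentiallySmallRel K B
  small_right : ∀ ⦃A B : C⦄ (f : A ⟶ B), J f →
    IsSequentiallySmallRel K A ∧ IsSequentiallySmallRel K B
  rlp_left : I.rlp = J.rlp ⊓ W
  llp_rlp_le : J.rlp.llp ≤ W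

lemma cell_le {I W : MorphismProperty C}
    [W.IsStableUnderCobaseChange]
    [MorphismProperty.IsStableUnderTransfiniteComposition.{v} W] (h : I ≤ W) :
    cell I ≤ W :=
  (MorphismProperty.transfiniteCompositions_monotone.{v}
    (MorphismProperty.pushouts_le_iff.2 h)).trans W.transfiniteCompositions_le

lemma IsSequentiallySmallRel.isCardinalSmallRel_cell {I K : MorphismProperty C}
    [K.IsStableUnderCobaseChange] [IsStableUnderTransfiniteComposition.{v} K] (hI : I ≤ K) {A : C}
    (hA : IsSequentiallySmallRel K A) (κ : Cardinal.{v}) : IsCardinalSmallRel κ (cell I) A := by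
  intro J _ _ _ _ _ _ F _ hF
  exact hA J F fun j => cell_le hI _ (hF j)

attribute [local instance] Cardinal.fact_isRegular_aleph0 Cardinal.orderBotAleph0OrdToType

lemma hasSmallObjectArgument_of_isSequentiallySmallRel [HasColimits C]
    {I K : MorphismProperty C} [MorphismProperty.IsSmall.{v} I]
    [K.IsStableUnderCobaseChange] [IsStableUnderCoproducts.{v} K] (hI : I ≤ K)
    (h : ∀ ⦃A B : C⦄ (f : A ⟶ B), I f → IsSequentiallySmallRel K A) :
    HasSmallObjectArgument.{v} I := by
  have : IsCardinalForSmallObjectArgument I Cardinal.aleph0.{v} :=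
    { preservesColimit := fun {A B X Y} i hi f hf => by
        have : NoMaxOrder Cardinal.aleph0.{v}.ord.ToType :=
          Cardinal.noMaxOrder le_rfl
        refine h i hi _ hf.F fun j => ?_
        have hj := (hf.attachCells j (not_isMax j)).pushouts_coproducts
        rw [ofHoms_homFamily] at hj
        exact pushouts_le_iff.2 (coproducts_le_iff.2 hI) _ hj }
  exact ⟨.aleph0, inferInstance, inferInstance, inferInstance⟩

namespace RecognitionData

variable {I J W K : MorphismProperty C} (h : RecognitionData I J W K)

include h

lemma hasSmallObjectArgument_left [HasColimits C] : HasSmallObjectArgument.{v} I := by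
  have := h.isSmall_left
  have := h.isStableUnderCobaseChange
  have := h.isStableUnderCoproducts
  exact hasSmallObjectArgument_of_isSequentiallySmallRel h.left_le
    fun _ _ f hf => (h.small_left f hf).1

lemma hasSmallObjectArgument_right [HasColimits C] : HasSmallObjectArgument.{v} J := by
  have := h.isSmall_right
  have := h.isStableUnderCobaseChange
  have := h.isStableUnderCoproducts
  exact hasSmallObjectArgument_of_isSequentiallySmallRel h.right_le
    fun _ _ f hf => (h.small_right f hf).1

lemma llp_inf_eq [HasColimits C] : I.rlp.llp ⊓ W = J.rlp.llp := by
  have := h.twoOutOfThree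
  have := h.hasSmallObjectArgument_right
  refine le_antisymm (fun X Y f hf => ?_) (le_inf (antitone_llp ?_) h.llp_rlp_le)
  · have hfac := factorizationData J.rlp.llp J.rlp f
    have hp : I.rlp hfac.p := by
      rw [h.rlp_left]
      refine ⟨hfac.hp, W.of_precomp hfac.i hfac.p (h.llp_rlp_le _ hfac.hi) ?_⟩
      rw [hfac.fac]
      exact hf.2
    have := hf.1 _ hp
    exact of_retract (RetractArrow.ofLeftLiftingProperty hfac.fac) hfac.hi
  · rw [h.rlp_left]
    exact inf_le_left

/-- The model structure with weak equivalences `W` and fibrations `J.rlp`. -/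
abbrev modelCategory [HasLimits C] [HasColimits C] : ModelCategory C :=
  letI : CategoryWithFibrations C := ⟨J.rlp⟩
  letI : CategoryWithCofibrations C := ⟨I.rlp.llp⟩
  letI : CategoryWithWeakEquivalences C := ⟨W⟩
  haveI : (weakEquivalences C).HasTwoOutOfThreeProperty := h.twoOutOfThree
  haveI := h.hasSmallObjectArgument_left
  haveI := h.hasSmallObjectArgument_right
  haveI : IsWeakFactorizationSystem (cofibrations C) (trivialFibrations C) := by
    have h1 : trivialFibrations C = I.rlp := h.rlp_left.symm
    have h2 : cofibrations C = I.rlp.llp := rfl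
    rw [h1, h2]
    exact ⟨rlp_llp_rlp I, rfl, inferInstance⟩
  haveI : IsWeakFactorizationSystem (trivialCofibrations C) (fibrations C) := by
    have h1 : trivialCofibrations C = J.rlp.llp := h.llp_inf_eq
    have h2 : fibrations C = J.rlp := rfl
    rw [h1, h2]
    exact ⟨rlp_llp_rlp J, rfl, inferInstance⟩
  ModelCategory.mk' C

variable [HasLimits C] [HasColimits C]

lemma isFinitelyGenerated :
    let := h.modelCategory
    IsFinitelyGenerated C I J := by
  let := h.modelCategory
  have := h.hasSmallObjectArgument_left
  have := h.hasSmallObjectArgument_right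
  have := h.isStableUnderCobaseChange
  have := h.isStableUnderTransfiniteComposition
  have h1 : trivialFibrations C = I.rlp := h.rlp_left.symm
  have h2 : cofibrations C = I.rlp.llp := rfl
  have h3 : trivialCofibrations C = J.rlp.llp := h.llp_inf_eq
  have h4 : fibrations C = J.rlp := rfl
  exact
    { hasLimits := inferInstance
      hasColimits := inferInstance
      functorial_left := by rw [h3, h4]; infer_instance
      functorial_right := by rw [h1, h2]; infer_instance
      isSmall_left := h.isSmall_left
      isSmall_right := h.isSmall_right
      small_dom_left := fun _ _ f hf =>
        ⟨0, (h.small_left f hf).1.isCardinalSmallRel_cell h.left_le _⟩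
      small_dom_right := fun _ _ f hf =>
        ⟨0, (h.small_right f hf).1.isCardinalSmallRel_cell h.right_le _⟩
      fibrations_eq := h4
      trivialFibrations_eq := h1
      finite_left := fun _ _ f hf =>
        ⟨⟨0, Cardinal.aleph0_pos, (h.small_left f hf).1.isCardinalSmallRel_cell h.left_le _⟩,
          ⟨0, Cardinal.aleph0_pos, (h.small_left f hf).2.isCardinalSmallRel_cell h.left_le _⟩⟩
      finite_right := fun _ _ f hf =>
        ⟨⟨0, Cardinal.aleph0_pos, (h.small_right f hf).1.isCardinalSmallRel_cell h.left_le _⟩,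
          ⟨0, Cardinal.aleph0_pos, (h.small_right f hf).2.isCardinalSmallRel_cell h.left_le _⟩⟩ }

end RecognitionData

end Recognition

end ModelStructure

namespace CategoryTheory

variable {C : Type u} [Category.{v} C] {D : Type u'} [Category.{v'} D] {F : C ⥤ D}

lemma Functor.FullyFaithful.hasLiftingProperty_iff (hF : F.FullyFaithful) {A B X Y : C}
    (i : A ⟶ B) (p : X ⟶ Y) :
    HasLiftingProperty (F.map i) (F.map p) ↔ HasLiftingProperty i p := by
  refine ⟨fun _ => ⟨fun {f g} sq => ?_⟩, fun _ => ⟨fun {f g} sq => ?_⟩⟩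
  · have sq' := sq.map F
    exact ⟨⟨hF.preimage sq'.lift, hF.map_injective (by simp), hF.map_injective (by simp)⟩⟩
  · have sq' : CommSq (hF.preimage f) i p (hF.preimage g) :=
      ⟨hF.map_injective (by simpa using sq.w)⟩
    refine ⟨⟨F.map sq'.lift, ?_, ?_⟩⟩
    · rw [← F.map_comp, sq'.fac_left, hF.map_preimage]
    · rw [← F.map_comp, sq'.fac_right, hF.map_preimage]

lemma Adjunction.hasLiftingProperty_map_counit [F.Full] [F.Faithful] {G : D ⥤ C} (adj : F ⊣ G)
    {A B : C} (i : A ⟶ B) (Y : D) : HasLiftingProperty (F.map i) (adj.counit.app Y) := by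
  rw [adj.hasLiftingProperty_iff]
  have : IsIso (G.map (adj.counit.app Y)) :=
    isIso_of_hom_comp_eq_id _ (adj.right_triangle_components Y)
  infer_instance

lemma preservesColimit_coyoneda_of_fullyFaithful {C : Type u} [Category.{v} C] {D : Type u'}
    [Category.{v} D] {F : C ⥤ D} (hF : F.FullyFaithful) {J : Type w} [Category.{w} J] (K : J ⥤ C)
    [PreservesColimit K F] (A : C)
    [PreservesColimit (K ⋙ F) (coyoneda.obj (Opposite.op (F.obj A)))] :
    PreservesColimit K (coyoneda.obj (Opposite.op A)) :=
  preservesColimit_of_natIso K (h := (NatIso.ofComponents (fun X => (hF.homEquiv).symm.toIso)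
    (fun f => by
      ext g
      apply hF.map_injective
      simp) :
    F ⋙ coyoneda.obj (Opposite.op (F.obj A)) ≅ coyoneda.obj (Opposite.op A)))

end CategoryTheory

namespace NumericallyGenerated

open BallHomotopy Set ModelStructure MorphismProperty

/-! ### The model structure on pointed spaces -/

instance : weakEqTop.{u}.HasTwoOutOfThreeProperty where
  comp_mem _ _ hf hg := hg.comp hf
  of_postcomp _ _ hg hfg := hg.of_comp_left hfg
  of_precomp _ _ hf hfg := hf.of_comp_right hfg

instance : weakEqNG.{u}.HasTwoOutOfThreeProperty where
  comp_mem _ _ hf hg := hg.comp hf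
  of_postcomp _ _ hg hfg := hg.of_comp_left hfg
  of_precomp _ _ hf hfg := hf.of_comp_right hfg

lemma isSequentiallySmallRel_addPoint (K : TopCat.{u}) [CompactSpace K] :
    IsSequentiallySmallRel pointedClosedT1Inclusions (addPoint.obj K) := by
  intro J _ _ _ _ _ F _ hF
  exact preservesColimit_coyoneda_addPoint F (fun j _ => hF j) K

lemma homotopyLifting_endpoints (E : Type*) [NormedAddCommGroup E] [NormedSpace ℝ E]
    (Y : Type*) [TopologicalSpace Y] :
    HomotopyLifting E (fun γ : C(unitInterval, Y) => (γ 0, γ 1)) := by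
  intro a H ha hH haH
  let τ : E × ℝ → ℝ := fun z => projIcc (0 : ℝ) 1 zero_le_one z.2
  have hτ : Continuous τ := by fun_prop
  have hτ0 : ∀ z, 0 ≤ τ z := fun z => (projIcc (0 : ℝ) 1 zero_le_one z.2).2.1
  have hτ1 : ∀ z, τ z ≤ 1 := fun z => (projIcc (0 : ℝ) 1 zero_le_one z.2).2.2
  have hτe : ∀ z ∈ cylinder E, τ z = z.2 := fun z hz => by
    simp [τ, projIcc_of_mem zero_le_one hz.2]
  let a' : E → C(unitInterval, Y) := fun x => a (radialRetraction x)
  have ha' : Continuous a' := ha.comp_continuous continuous_radialRetraction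
    radialRetraction_mem
  let H' : E × ℝ → Y × Y := fun z => H (radialRetraction z.1, τ z)
  have hH' : Continuous H' := hH.comp_continuous
    ((continuous_radialRetraction.comp continuous_fst).prodMk hτ)
    fun z => ⟨radialRetraction_mem _, hτ0 z, hτ1 z⟩
  have hH'e : ∀ z ∈ cylinder E, H' z = H z := fun z hz => by
    simp only [H']
    rw [radialRetraction_eq hz.1, hτe z hz]
  have hH'0 : ∀ x, H' (x, 0) = (a' x 0, a' x 1) := fun x => by
    have : τ (x, 0) = 0 := by simp [τ]
    simp only [H', this]
    exact haH _ (radialRetraction_mem _)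
  let G : (E × ℝ) × unitInterval → Y := fun w =>
    if 3 * (w.2 : ℝ) ≤ τ w.1 then (H' (w.1.1, τ w.1 - 3 * w.2)).1
    else if 3 * (1 - (w.2 : ℝ)) ≤ τ w.1 then (H' (w.1.1, τ w.1 - 3 * (1 - w.2))).2
    else a' w.1.1 (projIcc 0 1 zero_le_one ((3 * w.2 - τ w.1) / (3 - 2 * τ w.1)))
  have hG : Continuous G := by
    have hτ' : Continuous fun w : (E × ℝ) × unitInterval => τ w.1 := hτ.comp continuous_fst
    have hne : ∀ w : (E × ℝ) × unitInterval, 3 - 2 * τ w.1 ≠ 0 := fun w => by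
      linarith [hτ1 w.1]
    refine Continuous.if_le ?_ (Continuous.if_le ?_ ?_ (by fun_prop) hτ' ?_) (by fun_prop) hτ' ?_
    · exact continuous_fst.comp (hH'.comp (by fun_prop))
    · exact continuous_snd.comp (hH'.comp (by fun_prop))
    · exact (ha'.comp (by fun_prop)).eval (continuous_projIcc.comp
        (Continuous.div (by fun_prop) (by fun_prop) hne))
    · intro w hw
      rw [hw, sub_self, hH'0, show (3 * (w.2 : ℝ) - τ w.1) / (3 - 2 * τ w.1) = 1 by
        rw [div_eq_one_iff_eq (hne w)]
        linarith, projIcc_right]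
      rfl
    · intro w hw
      rw [hw, sub_self, hH'0, if_neg, zero_div, projIcc_left]
      · rfl
      · linarith [hτ1 w.1]
  refine ⟨ContinuousMap.curry ⟨G, hG⟩, (map_continuous _).continuousOn, fun x hx => ?_,
    fun z hz => ?_⟩
  · ext s
    change G ((x, 0), s) = a x s
    have hτx : τ (x, 0) = 0 := by simp [τ]
    have hax : a' x = a x := congrArg a (radialRetraction_eq hx)
    simp only [G, hτx]
    split_ifs with h1 h2
    · obtain rfl : s = 0 := Subtype.ext (le_antisymm (by
        rw [Icc.coe_zero]
        linarith) s.2.1)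
      simp [hH'0, hax]
    · obtain rfl : s = 1 := Subtype.ext (le_antisymm s.2.2 (by
        rw [Icc.coe_one]
        linarith))
      simp [hH'0, hax]
    · rw [hax, show (3 * (s : ℝ) - 0) / (3 - 2 * 0) = s by ring, projIcc_val]
  · change (G (z, 0), G (z, 1)) = H z
    have hz' : (z.1, τ z) = z := Prod.ext rfl (hτe z hz)
    have h1 : ¬ (3 : ℝ) ≤ τ z := by linarith [hτ1 z]
    simp [G, hτ0 z, h1, hz', hH'e z hz]

/-- The terminal pointed space. -/
abbrev trivialPointedSpace : PointedTop.{u} := Under.mk (𝟙 pt)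

/-- The space of paths in a pointed space, pointed by the constant path. -/
def pathSpace (X : PointedTop.{u}) : PointedTop.{u} :=
  Under.mk (Y := TopCat.of C(unitInterval, X.right))
    (TopCat.ofHom ⟨fun x => ContinuousMap.const _ (X.hom x),
      ContinuousMap.continuous_const'.comp X.hom.hom.continuous⟩)

/-- The square of a pointed space. -/
def square (X : PointedTop.{u}) : PointedTop.{u} :=
  Under.mk (Y := TopCat.of (X.right × X.right))
    (TopCat.ofHom ⟨fun x => (X.hom x, X.hom x),
      X.hom.hom.continuous.prodMk X.hom.hom.continuous⟩)

/-- The evaluation of paths at their end points. -/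
def evalEndpoints (X : PointedTop.{u}) : pathSpace X ⟶ square X :=
  Under.homMk (TopCat.ofHom ⟨fun γ : C(unitInterval, X.right) => (γ 0, γ 1),
    (continuous_eval_const _).prodMk (continuous_eval_const _)⟩)
    (by ext; rfl)

/-- The constant paths. -/
def constPath (X : PointedTop.{u}) : X ⟶ pathSpace X :=
  Under.homMk (TopCat.ofHom ⟨fun x => ContinuousMap.const _ x, ContinuousMap.continuous_const'⟩)
    (by ext; rfl)

lemma rlp_genTrivCofTop_trivial {X : PointedTop.{u}} (p : X ⟶ trivialPointedSpace) :
    genTrivCofTop.rlp p := by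
  rw [rlp_genTrivCofTop_iff]
  intro n a H ha hH haH
  exact ⟨fun z => a z.1, ha.comp continuousOn_fst fun z hz => hz.1, fun _ _ => rfl,
    fun _ _ => rfl⟩

lemma rlp_genTrivCofTop_evalEndpoints (X : PointedTop.{u}) :
    genTrivCofTop.rlp (evalEndpoints X) := by
  rw [rlp_genTrivCofTop_iff]
  exact fun n => homotopyLifting_endpoints _ _

lemma llp_rlp_genTrivCofTop_le : genTrivCofTop.{u}.rlp.llp ≤ weakEqTop := by
  intro X Y j hj
  have h1 := hj _ (rlp_genTrivCofTop_trivial (X := X) (Under.homMk (TopCat.ofHom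
    ⟨fun _ => PUnit.unit, continuous_const⟩)))
  have h2 := hj _ (rlp_genTrivCofTop_evalEndpoints Y)
  have sq1 : CommSq (𝟙 X) j (Under.homMk (V := trivialPointedSpace) (TopCat.ofHom
      ⟨fun _ => PUnit.unit, continuous_const⟩)) (Under.homMk (TopCat.ofHom
      ⟨fun _ => PUnit.unit, continuous_const⟩)) := ⟨rfl⟩
  let r : Y ⟶ X := sq1.lift
  have hr : j ≫ r = 𝟙 X := sq1.fac_left
  let g : Y ⟶ square Y := Under.homMk (TopCat.ofHom ⟨fun y => ((r ≫ j).right y, y),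
    (r ≫ j).right.hom.continuous.prodMk continuous_id⟩) (by
      ext x
      exact Prod.ext (ConcreteCategory.congr_hom (Under.w (r ≫ j)) x) rfl)
  have sq2 : CommSq (j ≫ constPath Y) j (evalEndpoints Y) g := ⟨by
    ext x
    refine Prod.ext (?_ : j.right x = (r ≫ j).right (j.right x)) (rfl : j.right x = _)
    have h : j ≫ r ≫ j = j := by rw [← Category.assoc, hr, Category.id_comp]
    exact (ConcreteCategory.congr_hom (congrArg CommaMorphism.right h) x).symm⟩
  have h3 : ∀ y, (evalEndpoints Y).right (sq2.lift.right y) = ((r ≫ j).right y, y) :=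
    fun y => ConcreteCategory.congr_hom (congrArg CommaMorphism.right sq2.fac_right) y
  let H : C(Y.right, C(unitInterval, Y.right)) := sq2.lift.right.hom
  have h4 : ∀ y, (H y 0, H y 1) = ((r ≫ j).right y, y) := h3
  refine isWeakHomotopyEquivalence_of_deformation (j := j.right.hom) (r := r.right.hom)
    (fun x => ConcreteCategory.congr_hom (congrArg CommaMorphism.right hr) x)
    (H := H) (fun y => congrArg Prod.fst (h4 y)) (fun y => congrArg Prod.snd (h4 y)) fun x t => ?_
  have h5 : H (j.right x) = ContinuousMap.const _ (j.right x) :=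
    ConcreteCategory.congr_hom (congrArg CommaMorphism.right sq2.fac_left) x
  exact DFunLike.congr_fun h5 t

lemma recognitionData_pointedTop :
    RecognitionData genCofTop.{u} genTrivCofTop weakEqTop pointedClosedT1Inclusions where
  twoOutOfThree := inferInstance
  isSmall_left := isSmall_ofHoms ..
  isSmall_right := isSmall_ofHoms ..
  isStableUnderCobaseChange := inferInstance
  isStableUnderCoproducts := inferInstance
  isStableUnderTransfiniteComposition := inferInstance
  left_le := genCofTop_le
  right_le := genTrivCofTop_le
  small_left := by
    rintro _ _ _ ⟨n⟩
    exact ⟨isSequentiallySmallRel_addPoint _, isSequentiallySmallRel_addPoint _⟩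
  small_right := by
    rintro _ _ _ ⟨n⟩
    exact ⟨isSequentiallySmallRel_addPoint _, isSequentiallySmallRel_addPoint _⟩
  rlp_left := by
    ext X Y p
    exact rlp_genCofTop_iff p
  llp_rlp_le := llp_rlp_genTrivCofTop_le

/-! ### The model structure on pointed numerically generated spaces -/

/-- The inclusion of pointed numerically generated spaces is fully faithful. -/
noncomputable def fullyFaithfulPointedInclusion : pointedInclusion.{u}.FullyFaithful := .ofFullyFaithful _

lemma rlp_genCofNG_iff {X Y : PointedNG.{u}} (p : X ⟶ Y) :
    genCofNG.rlp p ↔ genCofTop.rlp (pointedInclusion.map p) := by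
  refine ⟨?_, ?_⟩
  · rintro h _ _ _ ⟨n⟩
    exact (fullyFaithfulPointedInclusion.hasLiftingProperty_iff
      (addPointNG.map (boundaryInclusionNG n)) p).2 (h _ ⟨n⟩)
  · rintro h _ _ _ ⟨n⟩
    exact (fullyFaithfulPointedInclusion.hasLiftingProperty_iff
      (addPointNG.map (boundaryInclusionNG n)) p).1 (h _ ⟨n⟩)

lemma rlp_genTrivCofNG_iff {X Y : PointedNG.{u}} (p : X ⟶ Y) :
    genTrivCofNG.rlp p ↔ genTrivCofTop.rlp (pointedInclusion.map p) := by
  refine ⟨?_, ?_⟩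
  · rintro h _ _ _ ⟨n⟩
    exact (fullyFaithfulPointedInclusion.hasLiftingProperty_iff
      (addPointNG.map (diskCylinderInclusionNG n)) p).2 (h _ ⟨n⟩)
  · rintro h _ _ _ ⟨n⟩
    exact (fullyFaithfulPointedInclusion.hasLiftingProperty_iff
      (addPointNG.map (diskCylinderInclusionNG n)) p).1 (h _ ⟨n⟩)

lemma weakEqNG_iff {X Y : PointedNG.{u}} (f : X ⟶ Y) :
    weakEqNG f ↔ weakEqTop (pointedInclusion.map f) := Iff.rfl

lemma rlp_genCofNG_pointedNumericalization_map {X Y : PointedTop.{u}} {p : X ⟶ Y}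
    (hp : genCofTop.rlp p) : genCofNG.rlp (pointedNumericalization.map p) := by
  rintro _ _ _ ⟨n⟩
  exact (pointedInclusionAdjunction.hasLiftingProperty_iff
      (addPointNG.map (boundaryInclusionNG n)) p).1 (hp _ ⟨n⟩)

lemma rlp_genTrivCofNG_pointedNumericalization_map {X Y : PointedTop.{u}} {p : X ⟶ Y}
    (hp : genTrivCofTop.rlp p) : genTrivCofNG.rlp (pointedNumericalization.map p) := by
  rintro _ _ _ ⟨n⟩
  exact (pointedInclusionAdjunction.hasLiftingProperty_iff
      (addPointNG.map (diskCylinderInclusionNG n)) p).1 (hp _ ⟨n⟩)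

lemma llp_rlp_genCofTop_pointedInclusion_map {X Y : PointedNG.{u}} {f : X ⟶ Y}
    (hf : genCofNG.rlp.llp f) : genCofTop.rlp.llp (pointedInclusion.map f) :=
  fun _ _ _ hp => (pointedInclusionAdjunction.hasLiftingProperty_iff _ _).2
    (hf _ (rlp_genCofNG_pointedNumericalization_map hp))

lemma llp_rlp_genTrivCofTop_pointedInclusion_map {X Y : PointedNG.{u}} {f : X ⟶ Y}
    (hf : genTrivCofNG.rlp.llp f) : genTrivCofTop.rlp.llp (pointedInclusion.map f) :=
  fun _ _ _ hp => (pointedInclusionAdjunction.hasLiftingProperty_iff _ _).2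
    (hf _ (rlp_genTrivCofNG_pointedNumericalization_map hp))

lemma weakEqTop_counit (Y : PointedTop.{u}) :
    weakEqTop (pointedInclusionAdjunction.counit.app Y) := by
  refine ((rlp_genCofTop_iff _).1 ?_).2
  rintro _ _ _ ⟨n⟩
  exact pointedInclusionAdjunction.hasLiftingProperty_map_counit
    (addPointNG.map (boundaryInclusionNG n)) _

lemma isSequentiallySmallRel_of_pointedInclusion {A : PointedNG.{u}}
    (hA : IsSequentiallySmallRel pointedClosedT1Inclusions (pointedInclusion.obj A)) :
    IsSequentiallySmallRel (pointedClosedT1Inclusions.inverseImage pointedInclusion) A := by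
  intro J _ _ _ _ _ F _ hF
  have : PreservesWellOrderContinuousOfShape J pointedInclusion.{u} := ⟨fun _ _ => inferInstance⟩
  have := hA J (F ⋙ pointedInclusion) hF
  exact preservesColimit_coyoneda_of_fullyFaithful fullyFaithfulPointedInclusion F A

lemma recognitionData_pointedNG :
    RecognitionData genCofNG.{u} genTrivCofNG weakEqNG
      (pointedClosedT1Inclusions.inverseImage pointedInclusion) where
  twoOutOfThree := inferInstance
  isSmall_left := isSmall_ofHoms ..
  isSmall_right := isSmall_ofHoms ..
  isStableUnderCobaseChange := .inverseImage_of_preservesColimits _ _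
  isStableUnderCoproducts := .inverseImage_of_preservesColimits _ _
  isStableUnderTransfiniteComposition := .inverseImage_of_preservesColimits _ _
  left_le := by
    rintro _ _ _ ⟨n⟩
    exact genCofTop_le _ ⟨n⟩
  right_le := by
    rintro _ _ _ ⟨n⟩
    exact genTrivCofTop_le _ ⟨n⟩
  small_left := by
    rintro _ _ _ ⟨n⟩
    exact ⟨isSequentiallySmallRel_of_pointedInclusion
        (isSequentiallySmallRel_addPoint (TopCat.diskBoundary n)),
      isSequentiallySmallRel_of_pointedInclusion
        (isSequentiallySmallRel_addPoint (TopCat.disk n))⟩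
  small_right := by
    rintro _ _ _ ⟨n⟩
    exact ⟨isSequentiallySmallRel_of_pointedInclusion
        (isSequentiallySmallRel_addPoint (TopCat.disk n)),
      isSequentiallySmallRel_of_pointedInclusion
        (isSequentiallySmallRel_addPoint (diskCylinder n))⟩
  rlp_left := by
    ext X Y p
    rw [rlp_genCofNG_iff, rlp_genCofTop_iff, ← rlp_genTrivCofNG_iff, ← weakEqNG_iff]
    rfl
  llp_rlp_le _ _ _ hf := llp_rlp_genTrivCofTop_le _ (llp_rlp_genTrivCofTop_pointedInclusion_map hf)

end NumericallyGenerated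

theorem corollary3p4 :
    ∃ (_ : ModelCategory NumericallyGenerated.PointedNG.{u})
      (_ : ModelCategory NumericallyGenerated.PointedTop.{u}),
      (ModelStructure.IsFinitelyGenerated NumericallyGenerated.PointedNG.{u}
          NumericallyGenerated.genCofNG NumericallyGenerated.genTrivCofNG ∧
        weakEquivalences NumericallyGenerated.PointedNG.{u} = NumericallyGenerated.weakEqNG) ∧
      (ModelStructure.IsFinitelyGenerated NumericallyGenerated.PointedTop.{u}
          NumericallyGenerated.genCofTop NumericallyGenerated.genTrivCofTop ∧
        weakEquivalences NumericallyGenerated.PointedTop.{u} = NumericallyGenerated.weakEqTop) ∧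
      ModelStructure.IsLeftQuillenEquivalence NumericallyGenerated.pointedInclusion.{u} := by
  have hN := NumericallyGenerated.recognitionData_pointedNG.{u}
  have hT := NumericallyGenerated.recognitionData_pointedTop.{u}
  refine ⟨hN.modelCategory, hT.modelCategory, ⟨hN.isFinitelyGenerated, rfl⟩,
    ⟨hT.isFinitelyGenerated, rfl⟩, _, NumericallyGenerated.pointedInclusionAdjunction, ?_⟩
  let := hN.modelCategory
  let := hT.modelCategory
  refine
    { map_cofibrations := fun _ _ _ hf =>
        NumericallyGenerated.llp_rlp_genCofTop_pointedInclusion_map hf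
      map_trivialCofibrations := fun _ _ f hf => ?_
      weakEquivalence_iff := fun X Y _ _ f => ?_ }
  · have h1 : trivialCofibrations NumericallyGenerated.PointedNG.{u} = _ := hN.llp_inf_eq
    have h2 : trivialCofibrations NumericallyGenerated.PointedTop.{u} = _ := hT.llp_inf_eq
    rw [h1] at hf
    rw [h2]
    exact NumericallyGenerated.llp_rlp_genTrivCofTop_pointedInclusion_map hf
  · have hε := NumericallyGenerated.weakEqTop_counit Y
    have hfac := NumericallyGenerated.pointedInclusionAdjunction.homEquiv_counit
      (g := NumericallyGenerated.pointedInclusionAdjunction.homEquiv X Y f)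
    rw [Equiv.symm_apply_apply] at hfac
    change NumericallyGenerated.weakEqTop f ↔ NumericallyGenerated.weakEqTop
      (NumericallyGenerated.pointedInclusion.map
        (NumericallyGenerated.pointedInclusionAdjunction.homEquiv X Y f))
    constructor
    · intro h
      rw [hfac] at h
      exact MorphismProperty.of_postcomp _ _ _ hε h
    · intro h
      rw [hfac]
      exact MorphismProperty.comp_mem _ _ _ h hε
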